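/- Let $K$ be an infinite field which is not separably closed. A $K$-variety is a separated scheme of finite type over $K$ (not necessarily reduced or irreducible), and $V(K)$ denotes the set of $K$-points of a $K$-variety $V$. The étale-open topology on $V(K)$ is the topology generated by the sets $f(X(K))$, where $f : X \to V$ ranges over étale morphisms of $K$-varieties. Subsets of $V(K)$ carry the subspace topology. "Locally compact" means that every point has a neighbourhood basis of compact sets. (a) The following are equivalent: 1. there is a $K$-variety $V$ and an infinite étale-open subset $U$ of $V(K)$ such that $U$ is locally compact in the étale-open topology; 2. the étale-open topology on $\mathbb{A}^1(K)$ is locally compact. (b) The following are equivalent: 1. there is a $K$-variety $V$ and an infinite étale-open subset $U$ of $V(K)$ such that $U$ is locally compact and non-discrete in the étale-open topology; 2. the étale-open topology on $\mathbb{A}^1(K)$ is locally compact and non-discrete; 3. $K$ is a local field, i.e. there is a non-discrete locally compact Hausdorff topology on $K$ for which addition and multiplication $K \times K \to K$ and inversion $K^\times \to K^\times$ are continuous. -/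

import Mathlib

open CategoryTheory AlgebraicGeometry

universe u

noncomputable section

namespace EtaleOpen

/-- A `K`-scheme `V → Spec K` is a `K`-variety if it is separated and of finite type over `K`
(it need not be reduced, irreducible or nonempty). -/
structure IsVariety {K : Type u} [Field K] (V : Over (Spec (CommRingCat.of K))) : Prop where
  isSeparated : IsSeparated V.hom
  locallyOfFiniteType : LocallyOfFiniteType V.hom
  quasiCompact : QuasiCompact V.hom

/-- The set `V(K)` of `K`-points of `V`: the sections of the structure morphism `V → Spec K`. -/
def Points {K : Type u} [Field K] (V : Over (Spec (CommRingCat.of K))) : Type u :=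
  Over.mk (𝟙 (Spec (CommRingCat.of K))) ⟶ V

/-- The map `X(K) → V(K)` induced by a morphism `f : X → V` of `K`-schemes. -/
def Points.map {K : Type u} [Field K] {X V : Over (Spec (CommRingCat.of K))} (f : X ⟶ V)
    (x : Points X) : Points V :=
  CategoryStruct.comp (obj := Over (Spec (CommRingCat.of K))) x f

/-- `S ⊆ V(K)` is an étale image if it is the image of `X(K) → V(K)` for some étale morphism
`X → V` of `K`-varieties. -/
def IsEtaleImage {K : Type u} [Field K] {V : Over (Spec (CommRingCat.of K))}
    (S : Set (Points V)) : Prop :=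
  ∃ (X : Over (Spec (CommRingCat.of K))) (f : X ⟶ V),
    IsVariety X ∧ Etale f.left ∧ S = Set.range (Points.map f)

/-- The étale-open topology on `V(K)`: the topology generated by the étale images. -/
instance etaleOpenTopology {K : Type u} [Field K] (V : Over (Spec (CommRingCat.of K))) :
    TopologicalSpace (Points V) :=
  TopologicalSpace.generateFrom {S | IsEtaleImage S}

/-- The affine line `𝔸¹ = Spec K[x]` over `K`. -/
def affineLine (K : Type u) [Field K] : Over (Spec (CommRingCat.of K)) :=
  Over.mk (Spec.map (CommRingCat.ofHom (Polynomial.C : K →+* Polynomial K)))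

/-- `K` is a local field: it admits a non-discrete locally compact Hausdorff field topology. -/
def IsLocalField (K : Type u) [Field K] : Prop :=
  ∃ _τ : TopologicalSpace K, IsTopologicalDivisionRing K ∧ T2Space K ∧
    LocallyCompactSpace K ∧ ¬ DiscreteTopology K

end EtaleOpen

end

noncomputable section

namespace EtaleOpen

open Filter Topology

/-- If every nonempty open subset of `O` has oscillation larger than `ε` for the family
`f · y`, `y ∈ S`, then finitely many points of `X` never control the variation of `f` in `y`. -/
lemma exists_separating_pair {X Y : Type*} [TopologicalSpace X] [TopologicalSpace Y]
    {S : Set Y} (hS : IsCompact S) {f : X → Y → ℝ}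
    (h1 : ∀ y ∈ S, Continuous fun x ↦ f x y) (h2 : ∀ x, Continuous (f x)) {ε : ℝ} (hε : 0 < ε)
    {U : Set X} (hU : IsOpen U) (hne : U.Nonempty)
    (H : ∀ U' ⊆ U, IsOpen U' → U'.Nonempty → ∃ x ∈ U', ∃ x' ∈ U', ∃ y ∈ S,
      ε < |f x y - f x' y|) (F : Finset X) {δ : ℝ} (hδ : 0 < δ) :
    ∃ y ∈ S, ∃ z ∈ S, (∀ x ∈ F, |f x y - f x z| ≤ δ) ∧ ∃ x ∈ U, ε / 4 < |f x y - f x z| := by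
  by_contra! hcon
  have hcov : ∃ T : Finset Y, (∀ y ∈ T, y ∈ S) ∧ ∀ y ∈ S, ∃ z ∈ T, ∀ x ∈ F, |f x y - f x z| ≤ δ := by
    obtain ⟨T, hT, hT'⟩ := hS.elim_nhds_subcover
      (fun z ↦ {y | ∀ x ∈ F, |f x y - f x z| < δ}) (fun z _ ↦ by
        have : IsOpen {y | ∀ x ∈ F, |f x y - f x z| < δ} := by
          rw [show {y | ∀ x ∈ F, |f x y - f x z| < δ} = ⋂ x ∈ F, {y | |f x y - f x z| < δ} by
            ext; simp]
          refine isOpen_biInter_finset fun x _ ↦ ?_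
          exact isOpen_lt (by have := h2 x; fun_prop) continuous_const
        exact this.mem_nhds (by simpa using fun _ _ ↦ hδ))
    refine ⟨T, hT, fun y hy ↦ ?_⟩
    obtain ⟨z, hz, hz'⟩ := Set.mem_iUnion₂.1 (hT' hy)
    exact ⟨z, hz, fun x hx ↦ (hz' x hx).le⟩
  obtain ⟨T, hTS, hT⟩ := hcov
  obtain ⟨x₀, hx₀⟩ := hne
  let U' : Set X := U ∩ ⋂ y ∈ T, {x | |f x y - f x₀ y| < ε / 8}
  have hU' : IsOpen U' := hU.inter <| isOpen_biInter_finset fun y hy ↦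
    isOpen_lt (by have := h1 y (hTS y hy); fun_prop) continuous_const
  obtain ⟨x, hx, x', hx', y, hy, hlt⟩ := H U' Set.inter_subset_left hU'
    ⟨x₀, hx₀, by simp; intros; linarith⟩
  obtain ⟨z, hz, hyz⟩ := hT y hy
  have a1 := hcon y hy z (hTS z hz) hyz x hx.1
  have a2 := hcon y hy z (hTS z hz) hyz x' hx'.1
  have a3 : |f x z - f x₀ z| < ε / 8 := Set.mem_iInter₂.1 hx.2 z hz
  have a4 : |f x' z - f x₀ z| < ε / 8 := Set.mem_iInter₂.1 hx'.2 z hz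
  rw [abs_le] at a1 a2
  rw [abs_lt] at a3 a4
  rw [lt_abs] at hlt
  rcases hlt with h | h <;> linarith [a1.1, a1.2, a2.1, a2.2, a3.1, a3.2, a4.1, a4.2]

/-- A quantitative form of Namioka's theorem on separately continuous functions. -/
lemma exists_isOpen_forall_abs_sub_le {X Y : Type*} [TopologicalSpace X] [T2Space X]
    [LocallyCompactSpace X] [TopologicalSpace Y]
    {S : Set Y} (hS : IsCompact S) {f : X → Y → ℝ}
    (h1 : ∀ y ∈ S, Continuous fun x ↦ f x y) (h2 : ∀ x, Continuous (f x)) {ε : ℝ} (hε : 0 < ε)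
    {O : Set X} (hO : IsOpen O) (hne : O.Nonempty) :
    ∃ U ⊆ O, IsOpen U ∧ U.Nonempty ∧ ∀ x ∈ U, ∀ x' ∈ U, ∀ y ∈ S, |f x y - f x' y| ≤ ε := by
  classical
  by_contra! H
  obtain ⟨p, hp⟩ := hne
  obtain ⟨K₀, hK₀, hK₀O, hK₀c⟩ := local_compact_nhds (hO.mem_nhds hp)
  let St := {s : Set X × Finset X // IsOpen s.1 ∧ s.1.Nonempty ∧ s.1 ⊆ O}
  have step (n : ℕ) (s : St) : ∃ (t : St) (x : X) (y z : Y), y ∈ S ∧ z ∈ S ∧ x ∈ t.1.1 ∧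
      t.1.2 = insert x s.1.2 ∧ closure t.1.1 ⊆ s.1.1 ∧
      (∀ x ∈ s.1.2, |f x y - f x z| ≤ 1 / ((n : ℝ) + 1)) ∧
      ∀ x ∈ closure t.1.1, ε / 4 ≤ |f x y - f x z| := by
    obtain ⟨⟨U, F⟩, hUo, hUne, hUO⟩ := s
    obtain ⟨y, hy, z, hz, hF, x, hxU, hx⟩ := exists_separating_pair hS h1 h2 hε hUo hUne
      (fun U' hU' h3 h4 ↦ H U' (hU'.trans hUO) h3 h4) F (δ := 1 / ((n : ℝ) + 1)) (by positivity)
    have hc : Continuous fun x ↦ |f x y - f x z| := ((h1 y hy).sub (h1 z hz)).abs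
    have hW : U ∩ {x | ε / 4 < |f x y - f x z|} ∈ 𝓝 x :=
      (hUo.inter (isOpen_lt continuous_const hc)).mem_nhds ⟨hxU, hx⟩
    obtain ⟨V, ⟨hxV, hVo⟩, hV⟩ := (hasBasis_opens_closure x).mem_iff.1 hW
    exact ⟨⟨(V, insert x F), hVo, ⟨x, hxV⟩, (subset_closure.trans hV).trans
      (Set.inter_subset_left.trans hUO)⟩, x, y, z, hy, hz, hxV, rfl,
      hV.trans Set.inter_subset_left, hF, fun x hx ↦ (hV hx).2.le⟩
  choose next xs ys zs hys hzs hxs hF hcl hsmall hbig using step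
  let s₀ : St := ⟨(interior K₀, ∅), isOpen_interior, ⟨p, mem_interior_iff_mem_nhds.2 hK₀⟩,
    interior_subset.trans hK₀O⟩
  let s : ℕ → St := fun n ↦ Nat.rec s₀ next n
  have hs (n) : s (n + 1) = next n (s n) := rfl
  let x (n : ℕ) := xs n (s n)
  let y (n : ℕ) := ys n (s n)
  let z (n : ℕ) := zs n (s n)
  have hanti : Antitone fun n ↦ (s n).1.1 := antitone_nat_of_succ_le fun n ↦
    subset_closure.trans (hcl n (s n))
  have hx (n) : x n ∈ (s (n + 1)).1.1 := hxs n (s n)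
  have hxF (i n : ℕ) (h : i < n) : x i ∈ (s n).1.2 := by
    induction n, h using Nat.le_induction with
    | base => rw [hs, hF]; exact Finset.mem_insert_self _ _
    | succ n _ ih => rw [hs, hF]; exact Finset.mem_insert_of_mem ih
  have hlim (u : ℕ → X) (hu : ∀ n, u n ∈ K₀) :
      ∃ a ∈ K₀, Tendsto u (hyperfilter ℕ : Filter ℕ) (𝓝 a) := by
    obtain ⟨a, ha, h⟩ := hK₀c.ultrafilter_le_nhds ((hyperfilter ℕ).map u)
      (by simp only [Ultrafilter.coe_map, le_principal_iff, mem_map]; filter_upwards with n using hu n)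
    exact ⟨a, ha, h⟩
  have hlim' (u : ℕ → Y) (hu : ∀ n, u n ∈ S) :
      ∃ a ∈ S, Tendsto u (hyperfilter ℕ : Filter ℕ) (𝓝 a) := by
    obtain ⟨a, ha, h⟩ := hS.ultrafilter_le_nhds ((hyperfilter ℕ).map u)
      (by simp only [Ultrafilter.coe_map, le_principal_iff, mem_map]; filter_upwards with n using hu n)
    exact ⟨a, ha, h⟩
  have hle : (hyperfilter ℕ : Filter ℕ) ≤ atTop := by
    rw [← Nat.cofinite_eq_atTop]; exact hyperfilter_le_cofinite
  obtain ⟨a, -, ha⟩ := hlim x fun n ↦ interior_subset (hanti (Nat.zero_le (n + 1)) (hx n))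
  obtain ⟨b, hb, hyb⟩ := hlim' y fun n ↦ hys n (s n)
  obtain ⟨c, hc, hzc⟩ := hlim' z fun n ↦ hzs n (s n)
  have hacl (n) : a ∈ closure (s n).1.1 := by
    refine mem_closure_of_tendsto ha ?_
    filter_upwards [hle (Ici_mem_atTop n)] with k hk
    exact hanti (Nat.le_succ_of_le hk) (hx k)
  have heq (i) : f (x i) b = f (x i) c := by
    have t1 : Tendsto (fun n ↦ |f (x i) (y n) - f (x i) (z n)|) (hyperfilter ℕ : Filter ℕ)
        (𝓝 |f (x i) b - f (x i) c|) :=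
      ((((h2 (x i)).tendsto b).comp hyb).sub (((h2 (x i)).tendsto c).comp hzc)).abs
    have t2 : Tendsto (fun n : ℕ ↦ 1 / ((n : ℝ) + 1)) (hyperfilter ℕ : Filter ℕ) (𝓝 0) :=
      tendsto_one_div_add_atTop_nhds_zero_nat.mono_left hle
    have : |f (x i) b - f (x i) c| ≤ 0 := by
      refine le_of_tendsto_of_tendsto t1 t2 ?_
      filter_upwards [hle (Ioi_mem_atTop i)] with n hn
      exact hsmall n (s n) (x i) (hxF i n hn)
    exact sub_eq_zero.1 (abs_nonpos_iff.1 this)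
  have heq' : f a b = f a c := tendsto_nhds_unique (((h1 b hb).tendsto a).comp ha)
    ((((h1 c hc).tendsto a).comp ha).congr fun i ↦ (heq i).symm)
  have hge : ε / 4 ≤ |f a b - f a c| :=
    ge_of_tendsto' ((((h2 a).tendsto b).comp hyb).sub (((h2 a).tendsto c).comp hzc)).abs
      fun n ↦ hbig n (s n) a (hacl (n + 1))
  rw [heq', sub_self, abs_zero] at hge
  linarith

/-- Ellis' theorem for commutative groups with continuous inversion: a separately continuous
multiplication on a locally compact Hausdorff space is jointly continuous at `1`. -/
@[to_additive]
lemma tendsto_mul_one_of_separately {G : Type*} [CommGroup G] [TopologicalSpace G] [T2Space G]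
    [LocallyCompactSpace G] (hmul : ∀ a : G, Continuous fun x ↦ a * x)
    (hinv : Continuous fun x : G ↦ x⁻¹) :
    Tendsto (fun p : G × G ↦ p.1 * p.2) (𝓝 1 ×ˢ 𝓝 1) (𝓝 1) := by
  have hmul' (a : G) : Continuous fun x ↦ x * a := by simpa only [mul_comm] using hmul a
  intro W hW
  obtain ⟨W', hW', hW'o, h1W'⟩ := mem_nhds_iff.1 hW
  obtain ⟨φ, hφ0, hφ1, -⟩ := exists_continuous_zero_one_of_isCompact (isCompact_singleton (x := (1 : G)))
    (isClosed_compl_iff.2 hW'o) (by simpa using h1W')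
  obtain ⟨C, hC, h1C⟩ := exists_compact_mem_nhds (1 : G)
  have hS : IsCompact ((fun x : G ↦ x⁻¹) '' C) := hC.image hinv
  obtain ⟨U, hUC, hUo, ⟨a, haU⟩, hU⟩ := exists_isOpen_forall_abs_sub_le hS
    (f := fun x y ↦ φ (x * y)) (fun y _ ↦ φ.continuous.comp (hmul' y))
    (fun x ↦ φ.continuous.comp (hmul x)) (ε := 1 / 2) (by norm_num) isOpen_interior
    ⟨1, mem_interior_iff_mem_nhds.2 h1C⟩
  have e1 : ∀ᶠ g in 𝓝 (1 : G), a * g ∈ U :=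
    (hmul a).continuousAt.eventually_mem (by simpa using hUo.mem_nhds haU)
  have e2 : ∀ᶠ h in 𝓝 (1 : G), a * h⁻¹ ∈ C :=
    ((hmul a).comp hinv).continuousAt.eventually_mem
      (by simpa using mem_interior_iff_mem_nhds.1 (hUC haU))
  have e3 : ∀ᶠ h in 𝓝 (1 : G), φ h < 1 / 2 :=
    φ.continuous.continuousAt.eventually_lt continuousAt_const (by
      rw [hφ0 rfl]; norm_num)
  rw [mem_map]
  filter_upwards [e1.prod_mk (e2.and e3)] with ⟨g, h⟩ ⟨hg, hh, hφ⟩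
  have := hU (a * g) hg a haU (a⁻¹ * h) ⟨a * h⁻¹, hh, by simp [mul_comm]⟩
  rw [show a * g * (a⁻¹ * h) = g * h by rw [mul_mul_mul_comm]; simp, mul_inv_cancel_left] at this
  refine hW' (by_contra fun hn ↦ ?_)
  rw [hφ1 hn, Pi.one_apply] at this
  rw [abs_le] at this
  change φ h < 1 / 2 at hφ
  linarith [this.2]

open TensorProduct

section AlgebraicModel

variable {K : Type u} [Field K] {A B : Type u} [CommRing A] [Algebra K A] [CommRing B] [Algebra K B]

/-- The map on `K`-points induced by a homomorphism of `K`-algebras. -/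
def pullPt (φ : A →ₐ[K] B) (x : B →ₐ[K] K) : A →ₐ[K] K := x.comp φ

@[simp]
lemma pullPt_apply (φ : A →ₐ[K] B) (x : B →ₐ[K] K) (a : A) : pullPt φ x a = x (φ a) := rfl

/-- The étale images in the set of `K`-points of an affine scheme `Spec A`, given by étale
`A`-algebras. -/
def IsAlgEtaleImage (S : Set (A →ₐ[K] K)) : Prop :=
  ∃ (B : Type u) (_ : CommRing B) (_ : Algebra K B) (φ : A →ₐ[K] B),
    φ.toRingHom.Etale ∧ S = Set.range (pullPt φ)

/-- The étale-open topology on the `K`-points of an affine scheme. -/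
instance algEtaleTopology : TopologicalSpace (A →ₐ[K] K) :=
  TopologicalSpace.generateFrom {S | IsAlgEtaleImage S}

lemma IsAlgEtaleImage.isOpen {S : Set (A →ₐ[K] K)} (h : IsAlgEtaleImage S) : IsOpen S :=
  TopologicalSpace.isOpen_generateFrom_of_mem h

lemma IsAlgEtaleImage.univ : IsAlgEtaleImage (Set.univ : Set (A →ₐ[K] K)) :=
  ⟨A, _, _, AlgHom.id K A, .of_bijective Function.bijective_id,
    (Set.range_eq_univ.2 fun x ↦ ⟨x, AlgHom.comp_id x⟩).symm⟩

/-- The preimage of an étale image is an étale image. -/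
lemma IsAlgEtaleImage.preimage {S : Set (A →ₐ[K] K)} (h : IsAlgEtaleImage S) (φ : A →ₐ[K] B) :
    IsAlgEtaleImage (pullPt φ ⁻¹' S) := by
  obtain ⟨C, _, _, ψ, hψ, rfl⟩ := h
  algebraize [φ.toRingHom, ψ.toRingHom]
  have : IsScalarTower K A B := .of_algebraMap_eq' φ.comp_algebraMap.symm
  have : IsScalarTower K A C := .of_algebraMap_eq' ψ.comp_algebraMap.symm
  refine ⟨B ⊗[A] C, inferInstance, inferInstance,
    (Algebra.TensorProduct.includeLeft : B →ₐ[K] B ⊗[A] C), ?_, ?_⟩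
  · have : Algebra.Etale B (B ⊗[A] C) := inferInstance
    exact (RingHom.etale_algebraMap (R := B) (S := B ⊗[A] C)).2 this
  · ext x
    constructor
    · rintro ⟨y, hy⟩
      let _ : Algebra A K := (pullPt φ x).toRingHom.toAlgebra
      have : IsScalarTower K A K := .of_algebraMap_eq' (pullPt φ x).comp_algebraMap.symm
      let x' : B →ₐ[A] K := ⟨x.toRingHom, fun a ↦ rfl⟩
      let y' : C →ₐ[A] K := ⟨y.toRingHom, fun a ↦ DFunLike.congr_fun hy a⟩
      refine ⟨(Algebra.TensorProduct.lift x' y' fun _ _ ↦ .all _ _).restrictScalars K, ?_⟩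
      ext b
      change Algebra.TensorProduct.lift x' y' (fun _ _ ↦ .all _ _) (b ⊗ₜ[A] 1) = x b
      simp [x']
    · rintro ⟨z, rfl⟩
      refine ⟨z.comp (Algebra.TensorProduct.includeRight.restrictScalars K), ?_⟩
      ext a
      change z (1 ⊗ₜ[A] algebraMap A C a) = z (algebraMap A B a ⊗ₜ[A] 1)
      rw [Algebra.algebraMap_eq_smul_one, Algebra.algebraMap_eq_smul_one,
        TensorProduct.smul_tmul]

/-- The image of an étale image under an étale morphism is an étale image. -/
lemma IsAlgEtaleImage.image {S : Set (B →ₐ[K] K)} (h : IsAlgEtaleImage S) {φ : A →ₐ[K] B}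
    (hφ : φ.toRingHom.Etale) : IsAlgEtaleImage (pullPt φ '' S) := by
  obtain ⟨C, _, _, ψ, hψ, rfl⟩ := h
  exact ⟨C, _, _, ψ.comp φ, RingHom.Etale.stableUnderComposition _ _ hφ hψ,
    (Set.range_comp (pullPt φ) (pullPt ψ)).symm⟩

lemma IsAlgEtaleImage.inter {S T : Set (A →ₐ[K] K)} (hS : IsAlgEtaleImage S)
    (hT : IsAlgEtaleImage T) : IsAlgEtaleImage (S ∩ T) := by
  obtain ⟨B, _, _, φ, hφ, rfl⟩ := hS
  rw [Set.inter_comm, ← Set.image_preimage_eq_inter_range]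
  exact (hT.preimage φ).image hφ

variable (K A) in
lemma isTopologicalBasis_algEtaleImage :
    TopologicalSpace.IsTopologicalBasis {S : Set (A →ₐ[K] K) | IsAlgEtaleImage S} where
  exists_subset_inter S hS T hT _ hx := ⟨S ∩ T, hS.inter hT, hx, subset_rfl⟩
  sUnion_eq := Set.eq_univ_of_univ_subset fun _ _ ↦ ⟨Set.univ, .univ, trivial⟩
  eq_generateFrom := rfl

lemma continuous_pullPt (φ : A →ₐ[K] B) : Continuous (pullPt φ) :=
  continuous_generateFrom_iff.2 fun _ hS ↦ (IsAlgEtaleImage.preimage hS φ).isOpen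

lemma isOpenMap_pullPt {φ : A →ₐ[K] B} (hφ : φ.toRingHom.Etale) : IsOpenMap (pullPt φ) :=
  (isTopologicalBasis_algEtaleImage K B).isOpenMap_iff.2 fun _ hS ↦
    (IsAlgEtaleImage.image hS hφ).isOpen

lemma etale_toLocalizationAway (a : A) :
    (IsScalarTower.toAlgHom K A (Localization.Away a)).toRingHom.Etale :=
  (RingHom.etale_algebraMap (R := A) (S := Localization.Away a)).2 (.of_isLocalizationAway a)

lemma range_pullPt_localizationAway (a : A) :
    Set.range (pullPt (IsScalarTower.toAlgHom K A (Localization.Away a))) = {x | x a ≠ 0} := by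
  ext x
  constructor
  · rintro ⟨y, rfl⟩
    exact ((IsLocalization.Away.algebraMap_isUnit (S := Localization.Away a) a).map y).ne_zero
  · intro hx
    refine ⟨IsLocalization.liftAlgHom (M := Submonoid.powers a) (f := x) fun y ↦ ?_, ?_⟩
    · obtain ⟨_, n, rfl⟩ := y
      simpa using (IsUnit.mk0 _ hx).pow n
    · ext b
      simp

lemma injective_pullPt_localizationAway (a : A) :
    Function.Injective (pullPt (IsScalarTower.toAlgHom K A (Localization.Away a))) := by
  intro x y hxy
  have : x.toRingHom = y.toRingHom := IsLocalization.ringHom_ext (Submonoid.powers a)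
    (RingHom.ext fun b ↦ DFunLike.congr_fun hxy b)
  exact AlgHom.ext fun b ↦ DFunLike.congr_fun this b

lemma isOpenEmbedding_pullPt_localizationAway (a : A) :
    IsOpenEmbedding (pullPt (IsScalarTower.toAlgHom K A (Localization.Away a))) :=
  .of_continuous_injective_isOpenMap (continuous_pullPt _) (injective_pullPt_localizationAway a)
    (isOpenMap_pullPt (etale_toLocalizationAway a))

lemma isOpen_apply_ne_zero (a : A) : IsOpen {x : A →ₐ[K] K | x a ≠ 0} := by
  rw [← range_pullPt_localizationAway]
  exact (isOpenMap_pullPt (etale_toLocalizationAway a)).isOpen_range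

end AlgebraicModel

open Limits

section Bridge

variable {K : Type u} [Field K]

/-- The affine `K`-scheme `Spec A`. -/
def affineOver (K : Type u) [Field K] (A : Type u) [CommRing A] [Algebra K A] :
    Over (Spec (CommRingCat.of K)) :=
  Over.mk (Spec.map (CommRingCat.ofHom (algebraMap K A)))

variable {A B : Type u} [CommRing A] [Algebra K A] [CommRing B] [Algebra K B]

/-- The morphism `Spec B → Spec A` of `K`-schemes given by a homomorphism `A → B`. -/
def affineOver.map (φ : A →ₐ[K] B) : affineOver K B ⟶ affineOver K A :=
  Over.homMk (Spec.map (CommRingCat.ofHom φ.toRingHom)) (by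
    change Spec.map _ ≫ Spec.map _ = Spec.map _
    rw [← Spec.map_comp, ← CommRingCat.ofHom_comp]
    congr 2
    exact φ.comp_algebraMap)

/-- Morphisms `Spec B → Spec A` of `K`-schemes come from homomorphisms `A → B`. -/
lemma affineOver.exists_map_eq (f : affineOver K B ⟶ affineOver K A) :
    ∃ φ : A →ₐ[K] B, affineOver.map φ = f := by
  obtain ⟨φ, hφ⟩ := Spec.map_surjective f.left
  have hw : f.left ≫ Spec.map (CommRingCat.ofHom (algebraMap K A)) =
    Spec.map (CommRingCat.ofHom (algebraMap K B)) := Over.w f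
  have hw₂ : Spec.map (CommRingCat.ofHom (algebraMap K A) ≫ φ) =
      Spec.map (CommRingCat.ofHom (algebraMap K B)) := by
    rw [Spec.map_comp, hφ]; exact hw
  have hw' := Spec.map_injective hw₂
  refine ⟨⟨φ.hom, fun k ↦ ?_⟩, ?_⟩
  · exact congr($(hw').hom k)
  · ext1
    exact hφ

/-- The `K`-point of `Spec A` given by a homomorphism `A → K`. -/
def toPoint (x : A →ₐ[K] K) : Points (affineOver K A) :=
  Over.homMk (Spec.map (CommRingCat.ofHom x.toRingHom)) (by
    change Spec.map _ ≫ Spec.map _ = 𝟙 _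
    rw [← Spec.map_comp, ← CommRingCat.ofHom_comp, ← Spec.map_id]
    congr 1
    ext k
    exact x.commutes k)

lemma toPoint_bijective : Function.Bijective (toPoint : (A →ₐ[K] K) → Points (affineOver K A)) := by
  refine ⟨fun x y h ↦ ?_, fun p ↦ ?_⟩
  · have := Spec.map_injective congr(($h).left)
    ext a
    exact congr($(this).hom a)
  · obtain ⟨φ, hφ⟩ := Spec.map_surjective p.left
    have hw : p.left ≫ Spec.map (CommRingCat.ofHom (algebraMap K A)) = 𝟙 _ := Over.w p
    have hw₂ : Spec.map (CommRingCat.ofHom (algebraMap K A) ≫ φ) = Spec.map (𝟙 _) := by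
      rw [Spec.map_comp, hφ, Spec.map_id]; exact hw
    have hw' := Spec.map_injective hw₂
    refine ⟨⟨φ.hom, fun k ↦ congr($(hw').hom k)⟩, ?_⟩
    exact Over.OverMorphism.ext hφ

lemma map_toPoint (φ : A →ₐ[K] B) (x : B →ₐ[K] K) :
    Points.map (affineOver.map φ) (toPoint x) = toPoint (pullPt φ x) := by
  apply Over.OverMorphism.ext
  change Spec.map _ ≫ Spec.map _ = Spec.map _
  rw [← Spec.map_comp]
  rfl

lemma Points.map_comp {X Y Z : Over (Spec (CommRingCat.of K))} (f : X ⟶ Y) (g : Y ⟶ Z)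
    (x : Points X) : Points.map (f ≫ g) x = Points.map g (Points.map f x) :=
  (Category.assoc _ _ _).symm

lemma etale_affineOver_map_iff {φ : A →ₐ[K] B} :
    Etale (affineOver.map φ).left ↔ φ.toRingHom.Etale :=
  HasRingHomProperty.Spec_iff (P := @Etale) (φ := CommRingCat.ofHom φ.toRingHom)

/-- Spectra of finitely generated algebras are varieties. -/
lemma isVariety_affineOver [Algebra.FiniteType K A] : IsVariety (affineOver K A) where
  isSeparated := by dsimp [affineOver]; infer_instance
  locallyOfFiniteType := (HasRingHomProperty.Spec_iff (P := @LocallyOfFiniteType)).2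
    ((RingHom.finiteType_algebraMap (A := K) (B := A)).2 ‹_›)
  quasiCompact := by dsimp [affineOver]; infer_instance

/-- An affine chart of a `K`-scheme is the spectrum of a `K`-algebra. -/
lemma exists_affineOver_hom {V : Over (Spec (CommRingCat.of K))} {R : CommRingCat.{u}}
    (j : Spec R ⟶ V.left) :
    ∃ (_ : Algebra K R) (j' : affineOver K R ⟶ V), j'.left = j := by
  obtain ⟨φ, hφ⟩ := Spec.map_surjective (j ≫ V.hom)
  let _ : Algebra K R := φ.hom.toAlgebra
  exact ⟨inferInstance, Over.homMk j hφ.symm, rfl⟩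

lemma finiteType_of_isOpenImmersion {V : Over (Spec (CommRingCat.of K))} (hV : IsVariety V)
    (j : affineOver K A ⟶ V) [IsOpenImmersion j.left] : Algebra.FiniteType K A := by
  have := hV.locallyOfFiniteType
  have h : LocallyOfFiniteType (affineOver K A).hom := by
    rw [← Over.w j]; infer_instance
  exact (RingHom.finiteType_algebraMap (A := K) (B := A)).1
    ((HasRingHomProperty.Spec_iff (P := @LocallyOfFiniteType)).1 h)

/-- A `K`-point whose image lies in an open subscheme factors through it. -/
lemma mem_range_map_of_isOpenImmersion {U V : Over (Spec (CommRingCat.of K))} (j : U ⟶ V)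
    [IsOpenImmersion j.left] (x : Points V) {s : Spec (CommRingCat.of K)}
    (hs : x.left s ∈ Set.range j.left) :
    x ∈ Set.range (Points.map j) := by
  have hr : Set.range x.left ⊆ Set.range j.left := by
    rintro _ ⟨t, rfl⟩
    have : Subsingleton (Spec (CommRingCat.of K)) :=
      inferInstanceAs (Subsingleton (PrimeSpectrum K))
    rwa [this.elim t s]
  have hl := IsOpenImmersion.lift_fac j.left x.left hr
  refine ⟨Over.homMk (IsOpenImmersion.lift j.left x.left hr) ?_, ?_⟩
  · rw [← Over.w j, ← Category.assoc, hl]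
    exact Over.w x
  · exact Over.OverMorphism.ext hl

lemma isOpen_preimage_range_of_etale {X : Over (Spec (CommRingCat.of K))}
    (f : X ⟶ affineOver K A) [Etale f.left] :
    IsOpen (toPoint ⁻¹' Set.range (Points.map f) : Set (A →ₐ[K] K)) := by
  rw [isOpen_iff_forall_mem_open]
  rintro x ⟨y, hy⟩
  let s : Spec (CommRingCat.of K) := (⟨⊥, Ideal.isPrime_bot⟩ : PrimeSpectrum K)
  let 𝒰 := X.left.affineCover
  obtain ⟨_, j, hj⟩ := exists_affineOver_hom (V := X) (𝒰.f (𝒰.idx (y.left s)))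
  have : IsOpenImmersion j.left := by rw [hj]; exact 𝒰.map_prop _
  obtain ⟨z, hz⟩ := mem_range_map_of_isOpenImmersion j y (s := s)
    (by rw [hj]; exact 𝒰.covers (y.left s))
  obtain ⟨z, rfl⟩ := toPoint_bijective.2 z
  obtain ⟨φ, hφ⟩ := affineOver.exists_map_eq (j ≫ f)
  have hφe : φ.toRingHom.Etale := by
    rw [← etale_affineOver_map_iff, hφ]
    change Etale (j.left ≫ f.left)
    infer_instance
  refine ⟨Set.range (pullPt φ), ?_, IsAlgEtaleImage.isOpen ⟨_, _, _, φ, hφe, rfl⟩, z, ?_⟩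
  · rintro _ ⟨w, rfl⟩
    exact ⟨Points.map j (toPoint w), by rw [← Points.map_comp, ← hφ, map_toPoint]⟩
  · apply toPoint_bijective.1
    rw [← map_toPoint, hφ, Points.map_comp, hz, hy]

lemma continuous_map_toPoint {V : Over (Spec (CommRingCat.of K))} (j : affineOver K A ⟶ V) :
    Continuous fun x : A →ₐ[K] K ↦ Points.map j (toPoint x) := by
  refine continuous_generateFrom_iff.2 ?_
  rintro _ ⟨X, f, -, hf, rfl⟩
  let P : Over (Spec (CommRingCat.of K)) :=
    Over.mk (pullback.snd f.left j.left ≫ (affineOver K A).hom)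
  let g : P ⟶ affineOver K A := Over.homMk (pullback.snd f.left j.left) rfl
  have : Etale g.left := by
    change Etale (pullback.snd f.left j.left)
    infer_instance
  convert isOpen_preimage_range_of_etale g using 1
  ext x
  constructor
  · rintro ⟨y, hy⟩
    have hy' : y.left ≫ f.left = (toPoint x).left ≫ j.left := congr(($hy).left)
    refine ⟨Over.homMk (pullback.lift y.left (toPoint x).left hy') ?_, ?_⟩
    · change pullback.lift _ _ _ ≫ pullback.snd _ _ ≫ _ = _
      rw [pullback.lift_snd_assoc]
      exact Over.w (toPoint x)
    · apply Over.OverMorphism.ext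
      exact pullback.lift_snd _ _ _
  · rintro ⟨y, hy⟩
    have hy' : y.left ≫ pullback.snd f.left j.left = (toPoint x).left := congr(($hy).left)
    refine ⟨Over.homMk (y.left ≫ pullback.fst f.left j.left) ?_, ?_⟩
    · rw [Category.assoc, ← Over.w f, pullback.condition_assoc, Over.w j]
      exact Over.w y
    · apply Over.OverMorphism.ext
      change (y.left ≫ pullback.fst f.left j.left) ≫ f.left = (toPoint x).left ≫ j.left
      rw [Category.assoc, pullback.condition, ← Category.assoc, hy']

/-- On `K`-points, affine charts are open embeddings for the étale-open topology. -/
lemma isOpenEmbedding_map_toPoint {V : Over (Spec (CommRingCat.of K))} (j : affineOver K A ⟶ V)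
    [IsOpenImmersion j.left] [Algebra.FiniteType K A] :
    IsOpenEmbedding fun x : A →ₐ[K] K ↦ Points.map j (toPoint x) := by
  refine .of_continuous_injective_isOpenMap (continuous_map_toPoint j) ?_ ?_
  · intro x y hxy
    apply toPoint_bijective.1
    have h : (toPoint x).left ≫ j.left = (toPoint y).left ≫ j.left := congr(($hxy).left)
    exact Over.OverMorphism.ext ((cancel_mono j.left).1 h)
  · rw [(isTopologicalBasis_algEtaleImage K A).isOpenMap_iff]
    rintro _ ⟨B, _, _, φ, hφ, rfl⟩
    refine TopologicalSpace.isOpen_generateFrom_of_mem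
      ⟨affineOver K B, affineOver.map φ ≫ j, ?_, ?_, ?_⟩
    · have : Algebra.FiniteType K B := by
        algebraize [φ.toRingHom]
        have : IsScalarTower K A B := .of_algebraMap_eq' φ.comp_algebraMap.symm
        exact .trans (S := A) inferInstance inferInstance
      exact isVariety_affineOver
    · have := etale_affineOver_map_iff.2 hφ
      change Etale ((affineOver.map φ).left ≫ j.left)
      infer_instance
    · ext p
      constructor
      · rintro ⟨_, ⟨x, rfl⟩, rfl⟩
        exact ⟨toPoint x, by rw [Points.map_comp, map_toPoint]⟩
      · rintro ⟨q, rfl⟩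
        obtain ⟨x, rfl⟩ := toPoint_bijective.2 q
        exact ⟨_, ⟨x, rfl⟩, by rw [Points.map_comp, map_toPoint]⟩

variable (K A) in
/-- For finitely generated `A`, the two descriptions of the étale-open topology on the `K`-points
of `Spec A` agree. -/
def toPointHomeomorph [Algebra.FiniteType K A] : (A →ₐ[K] K) ≃ₜ Points (affineOver K A) :=
  have : IsOpenEmbedding (toPoint : (A →ₐ[K] K) → Points (affineOver K A)) := by
    have : IsOpenImmersion (𝟙 (affineOver K A) : affineOver K A ⟶ affineOver K A).left := by
      rw [Over.id_left]; infer_instance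
    convert isOpenEmbedding_map_toPoint (𝟙 (affineOver K A)) using 2 with x
    exact (Category.comp_id _).symm
  (Equiv.ofBijective toPoint toPoint_bijective).toHomeomorphOfIsInducing this.isInducing

/-- A variety is covered by finitely many affine charts. -/
lemma exists_finite_charts {V : Over (Spec (CommRingCat.of K))} (hV : IsVariety V) :
    ∃ (ι : Type u) (_ : Finite ι) (A : ι → Type u) (_ : ∀ i, CommRing (A i))
      (_ : ∀ i, Algebra K (A i)) (j : ∀ i, affineOver K (A i) ⟶ V),
      (∀ i, IsOpenImmersion (j i).left) ∧
      ∀ x : Points V, ∃ i, ∃ y : A i →ₐ[K] K, Points.map (j i) (toPoint y) = x := by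
  have := hV.quasiCompact
  have : CompactSpace V.left := by
    have := (quasiCompact_iff_compactSpace (f := V.hom)).1 this
    exact this
  have H (p : V.left) : ∃ (A : Type u) (_ : CommRing A) (_ : Algebra K A)
      (j : affineOver K A ⟶ V), IsOpenImmersion j.left ∧ p ∈ Set.range j.left := by
    let 𝒰 := V.left.affineCover
    obtain ⟨_, j, hj⟩ := exists_affineOver_hom (V := V) (𝒰.f (𝒰.idx p))
    exact ⟨_, _, _, j, by rw [hj]; exact 𝒰.map_prop _, by rw [hj]; exact 𝒰.covers p⟩
  choose A iA aA j hj hp using H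
  obtain ⟨t, ht⟩ := CompactSpace.elim_nhds_subcover (fun p ↦ Set.range (j p).left)
    fun p ↦ (IsOpenImmersion.isOpen_range (j p).left).mem_nhds (hp p)
  refine ⟨t, inferInstance, fun i ↦ A i, fun i ↦ iA i, fun i ↦ aA i, fun i ↦ j i, fun i ↦ hj i,
    fun x ↦ ?_⟩
  let s : Spec (CommRingCat.of K) := (⟨⊥, Ideal.isPrime_bot⟩ : PrimeSpectrum K)
  obtain ⟨p, hpt, hps⟩ := Set.mem_iUnion₂.1 (ht.ge (Set.mem_univ (x.left s)))
  obtain ⟨y, hy⟩ := mem_range_map_of_isOpenImmersion (j p) x hps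
  obtain ⟨y, rfl⟩ := toPoint_bijective.2 y
  exact ⟨⟨p, hpt⟩, y, hy⟩

end Bridge

section PointwiseLocallyCompact

/-- `x` has a neighbourhood basis of compact sets. -/
def LocallyCompactAt {X : Type*} [TopologicalSpace X] (x : X) : Prop :=
  ∀ N ∈ 𝓝 x, ∃ C ∈ 𝓝 x, C ⊆ N ∧ IsCompact C

lemma locallyCompactSpace_iff_forall {X : Type*} [TopologicalSpace X] :
    LocallyCompactSpace X ↔ ∀ x : X, LocallyCompactAt x :=
  ⟨fun h ↦ h.local_compact_nhds, fun h ↦ ⟨h⟩⟩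

lemma _root_.Topology.IsOpenEmbedding.locallyCompactAt_iff {X Y : Type*} [TopologicalSpace X]
    [TopologicalSpace Y] {e : X → Y} (he : IsOpenEmbedding e) {x : X} :
    LocallyCompactAt (e x) ↔ LocallyCompactAt x := by
  constructor
  · intro h N hN
    obtain ⟨C, hC, hCN, hCc⟩ := h (e '' N) (he.isOpenMap.image_mem_nhds hN)
    refine ⟨e ⁻¹' C, he.continuous.continuousAt hC, fun y hy ↦ ?_,
      he.isInducing.isCompact_preimage' hCc (hCN.trans (Set.image_subset_range _ _))⟩
    obtain ⟨z, hz, hzy⟩ := hCN hy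
    rwa [← he.injective hzy]
  · intro h N hN
    obtain ⟨C, hC, hCN, hCc⟩ := h (e ⁻¹' N) (he.continuous.continuousAt hN)
    exact ⟨e '' C, he.isOpenMap.image_mem_nhds hC, Set.image_subset_iff.2 hCN,
      hCc.image he.continuous⟩

lemma locallyCompactSpace_subtype_iff {X : Type*} [TopologicalSpace X] {U : Set X}
    (hU : IsOpen U) : LocallyCompactSpace U ↔ ∀ x ∈ U, LocallyCompactAt x := by
  rw [locallyCompactSpace_iff_forall, Subtype.forall]
  exact forall₂_congr fun x hx ↦ (hU.isOpenEmbedding_subtypeVal.locallyCompactAt_iff (x := ⟨x, hx⟩)).symm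

end PointwiseLocallyCompact

section DensePoints

variable {K : Type u} [Field K] {A : Type u} [CommRing A] [Algebra K A]

/-- An infinite set of points contains an infinite subset whose vanishing ideal is prime. -/
lemma exists_prime_vanishing [IsNoetherianRing A] {U : Set (A →ₐ[K] K)} (hU : U.Infinite) :
    ∃ (D : Set (A →ₐ[K] K)) (I : Ideal A), D ⊆ U ∧ D.Infinite ∧ I.IsPrime ∧
      ∀ a, a ∈ I ↔ ∀ x ∈ D, x a = 0 := by
  let idl (S : Set (A →ₐ[K] K)) : Ideal A := ⨅ x ∈ S, RingHom.ker x
  have hidl (S a) : a ∈ idl S ↔ ∀ x ∈ S, x a = 0 := by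
    simp [idl, Submodule.mem_iInf, RingHom.mem_ker]
  obtain ⟨_, ⟨D, ⟨hDU, hD⟩, rfl⟩, hmax⟩ := set_has_maximal_iff_noetherian.2 ‹IsNoetherianRing A›
    (idl '' {S | S ⊆ U ∧ S.Infinite}) ⟨_, U, ⟨subset_rfl, hU⟩, rfl⟩
  have key (S) (hS : S ⊆ D) (hSi : S.Infinite) (a) (ha : ∀ x ∈ S, x a = 0) : a ∈ idl D := by
    have hle : idl D ≤ idl S := fun b hb ↦ (hidl _ _).2 fun x hx ↦ (hidl _ _).1 hb x (hS hx)
    have heq : idl D = idl S := hle.eq_of_not_lt (hmax _ ⟨S, ⟨hS.trans hDU, hSi⟩, rfl⟩)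
    rw [heq, hidl]
    exact ha
  refine ⟨D, idl D, hDU, hD, ⟨?_, ?_⟩, hidl D⟩
  · obtain ⟨x, hx⟩ := hD.nonempty
    rw [Ideal.ne_top_iff_one, hidl]
    intro h
    simpa using h x hx
  · intro a b hab
    rw [hidl] at hab
    have : D = (D ∩ {x | x a = 0}) ∪ (D ∩ {x | x b = 0}) := by
      rw [← Set.inter_union_distrib_left]
      refine (Set.inter_eq_left.2 fun x hx ↦ ?_).symm
      simpa using hab x hx
    rw [this, Set.infinite_union] at hD
    rcases hD with h | h
    · exact .inl (key _ Set.inter_subset_left h a fun x hx ↦ hx.2)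
    · exact .inr (key _ Set.inter_subset_left h b fun x hx ↦ hx.2)

/-- In characteristic `p`, taking `p`-th powers preserves linear independence of functions. -/
lemma linearIndependent_pow_of_forall {D ι : Type*} [Fintype ι] (p : ℕ) [ExpChar K p]
    (v : ι → D → K) (hv : ∀ c : ι → K, (∀ x, ∑ i, c i * v i x = 0) → c = 0)
    (c : ι → K) (hc : ∀ x, ∑ i, c i * v i x ^ p = 0) : c = 0 := by
  classical
  let P : Submodule K (ι → K) :=
    { carrier := {w | ∑ i, c i * w i ^ p = 0}
      add_mem' := by
        intro a b ha hb
        simp only [Set.mem_ofPred_eq, Pi.add_apply, add_pow_expChar, mul_add,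
          Finset.sum_add_distrib] at *
        rw [ha, hb, add_zero]
      zero_mem' := by
        simp [(expChar_pos K p).ne']
      smul_mem' := by
        intro r a ha
        simp only [Set.mem_ofPred_eq, Pi.smul_apply, smul_eq_mul, mul_pow] at *
        simp_rw [mul_left_comm _ (r ^ p)]
        rw [← Finset.mul_sum, ha, mul_zero] }
  have htop : P = ⊤ := by
    by_contra hne
    obtain ⟨f, hf0, hf⟩ := Submodule.exists_le_ker_of_lt_top P (lt_top_iff_ne_top.2 hne)
    apply hf0
    have hfe (w : ι → K) : f w = ∑ i, f (Pi.single i 1) * w i := by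
      conv_lhs => rw [pi_eq_sum_univ' w, map_sum]
      refine Finset.sum_congr rfl fun i _ ↦ ?_
      rw [map_smul, smul_eq_mul, mul_comm]
    have h0 := hv (fun i ↦ f (Pi.single i 1)) fun x ↦ by
      rw [← hfe fun i ↦ v i x]
      exact hf (hc x)
    ext i
    simpa using congr_fun h0 i
  funext j
  have hj : Pi.single j 1 ∈ P := htop ▸ Submodule.mem_top
  change ∑ i, c i * (Pi.single j 1 : ι → K) i ^ p = 0 at hj
  rw [Finset.sum_eq_single j] at hj
  · simpa using hj
  · intro i _ hij
    simp [hij, (expChar_pos K p).ne']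
  · simp

/-- The function field of an integral affine scheme of finite type with a dense set of `K`-points
is formally smooth over `K`. -/
lemma formallySmooth_of_dense_points [IsDomain A] [Algebra.FiniteType K A]
    {D : Set (A →ₐ[K] K)} (hD : ∀ a, (∀ x ∈ D, x a = 0) → a = 0)
    (L : Type u) [Field L] [Algebra K L] [Algebra A L] [IsScalarTower K A L] [IsFractionRing A L] :
    Algebra.FormallySmooth K L := by
  have : Algebra.EssFiniteType A L := .of_isLocalization _ (nonZeroDivisors A)
  have : Algebra.EssFiniteType K L := .comp K A L
  obtain _ | ⟨p, hp, hpK⟩ := CharP.exists' K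
  · infer_instance
  have : ExpChar K p := .prime hp.out
  have : CharP L p := charP_of_injective_algebraMap (algebraMap K L).injective p
  have H (s : Finset L) (hs : LinearIndepOn K _root_.id (s : Set L)) :
      LinearIndepOn K (· ^ p) (s : Set L) := by
    obtain ⟨d, hd⟩ := IsLocalization.exist_integer_multiples_of_finset (nonZeroDivisors A) s
    choose r hr using hd
    have hd0 : algebraMap A L d ≠ 0 := by
      simp
    have hinj : Function.Injective (algebraMap A L) := IsFractionRing.injective A L
    have hmem (a : s) : algebraMap A L (r a a.2) = algebraMap A L d * a := by
      rw [hr, Algebra.smul_def]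
    have hs' : LinearIndependent K (fun a : s ↦ (a : L)) := hs
    change LinearIndependent K (fun a : s ↦ (a : L) ^ p)
    rw [Fintype.linearIndependent_iff] at hs' ⊢
    intro c hc
    refine congr_fun (linearIndependent_pow_of_forall p
      (fun (a : s) (x : D) ↦ x.1 (r a a.2)) ?_ c ?_)
    · intro c hc
      funext a
      refine hs' c ?_ a
      have h0 : ∑ a : s, c a • r a a.2 = 0 := hD _ fun x hx ↦ by
        rw [map_sum]; simpa using hc ⟨x, hx⟩
      have := congr(algebraMap A L $h0)
      simp_rw [map_sum, map_zero, Algebra.smul_def, map_mul, hmem,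
        ← IsScalarTower.algebraMap_apply, mul_left_comm _ (algebraMap A L d)] at this
      rw [← Finset.mul_sum, mul_eq_zero] at this
      simpa [Algebra.smul_def] using this.resolve_left hd0
    · intro x
      have h0 : ∑ a : s, c a • r a a.2 ^ p = 0 := hinj <| by
        simp_rw [map_sum, map_zero, Algebra.smul_def, map_mul, map_pow, hmem,
          ← IsScalarTower.algebraMap_apply, mul_pow, mul_left_comm _ (algebraMap A L d ^ p)]
        rw [← Finset.mul_sum]
        simp_rw [← Algebra.smul_def]
        rw [hc, mul_zero]
      simpa [map_sum] using congr(x.1 $h0)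
  obtain ⟨s, hs, Hs⟩ :=
    exists_isTranscendenceBasis_and_isSeparable_of_linearIndepOn_pow_of_essFiniteType p hp.out H
  have : Algebra.IsSeparable (IntermediateField.adjoin K (Set.range ((↑) : s → L))) L := by
    convert! Hs <;> simp
  exact .of_algebraicIndependent_of_isSeparable hs.1

/-- An integral affine scheme with an infinite dense set of `K`-points has a nonempty open
subscheme which is étale over a positive-dimensional affine space. -/
lemma exists_etale_mvPolynomial [IsDomain A] [Algebra.FiniteType K A]
    {D : Set (A →ₐ[K] K)} (hDi : D.Infinite) (hD : ∀ a, (∀ x ∈ D, x a = 0) → a = 0) :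
    ∃ f : A, f ≠ 0 ∧ ∃ (n : ℕ) (ψ : MvPolynomial (Fin (n + 1)) K →ₐ[K] Localization.Away f),
      ψ.toRingHom.Etale := by
  have : Algebra.FinitePresentation K A := .of_finiteType.1 inferInstance
  have hs : Algebra.IsSmoothAt K (⊥ : Ideal A) := by
    have aux : ∀ M : Submonoid A, M = nonZeroDivisors A → IsFractionRing A (Localization M) := by
      rintro _ rfl; infer_instance
    have : IsFractionRing A (Localization.AtPrime (⊥ : Ideal A)) :=
      aux _ (by ext a; simp [Ideal.primeCompl])
    have := formallySmooth_of_dense_points hD (FractionRing A)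
    exact .of_equiv ((IsLocalization.algEquiv (nonZeroDivisors A) (FractionRing A)
      (Localization.AtPrime (⊥ : Ideal A))).restrictScalars K)
  obtain ⟨f, hf, n, alg, tow, hst⟩ :=
    Algebra.IsSmoothAt.exists_isStandardEtale_mvPolynomial (R := K) (p := (⊥ : Ideal A))
  have hf0 : f ≠ 0 := by simpa using hf
  have hle : Submonoid.powers f ≤ nonZeroDivisors A := by
    rw [Submonoid.powers_le]; exact mem_nonZeroDivisors_of_ne_zero hf0
  refine ⟨f, hf0, ?_⟩
  rcases n with _ | n
  · exfalso
    have e1 : Algebra.Etale K (MvPolynomial (Fin 0) K) :=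
      .of_equiv (MvPolynomial.isEmptyAlgEquiv K (Fin 0)).symm
    have e2 : Algebra.Etale (MvPolynomial (Fin 0) K) (Localization.Away f) := inferInstance
    have e3 : Algebra.Etale K (Localization.Away f) :=
      .comp K (MvPolynomial (Fin 0) K) (Localization.Away f)
    have : Module.Finite K (Localization.Away f) :=
      Algebra.FormallyUnramified.finite_of_free K (Localization.Away f)
    have hinj : Function.Injective (IsScalarTower.toAlgHom K A (Localization.Away f)) :=
      IsLocalization.injective _ hle
    have : Module.Finite K A := .of_injective
      (IsScalarTower.toAlgHom K A (Localization.Away f)).toLinearMap hinj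
    exact hDi (Set.toFinite D)
  · exact ⟨n, IsScalarTower.toAlgHom K _ _, (RingHom.etale_algebraMap
      (R := MvPolynomial (Fin (n + 1)) K) (S := Localization.Away f)).2 inferInstance⟩

end DensePoints

section LineOfVariety

variable {K : Type u} [Field K] {A B : Type u} [CommRing A] [Algebra K A] [CommRing B] [Algebra K B]

lemma pullPt_comp {C : Type u} [CommRing C] [Algebra K C] (φ : A →ₐ[K] B) (ψ : B →ₐ[K] C)
    (x : C →ₐ[K] K) : pullPt (ψ.comp φ) x = pullPt φ (pullPt ψ x) := rfl

lemma algHom_apply_C (x : Polynomial K →ₐ[K] K) (c : K) : x (Polynomial.C c) = c := x.commutes c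

/-- Local compactness passes to étale coordinates on a closed subscheme. -/
lemma LocallyCompactAt.pullPt_of_etale {σ : Type} {q : A →ₐ[K] B} (hq : Function.Surjective q)
    {ψ : MvPolynomial σ K →ₐ[K] B} (hψ : ψ.toRingHom.Etale) {x : B →ₐ[K] K}
    (h : LocallyCompactAt (pullPt q x)) : LocallyCompactAt (pullPt ψ x) := by
  choose r hr using hq
  let ε : MvPolynomial σ K →ₐ[K] A := MvPolynomial.aeval fun i ↦ r (ψ (.X i))
  have hε : q.comp ε = ψ := MvPolynomial.algHom_ext fun i ↦ by simp [ε, hr]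
  intro N hN
  rw [← hε, pullPt_comp] at hN
  obtain ⟨C, hC, hCN, hCc⟩ := h _ ((continuous_pullPt ε).continuousAt hN)
  refine ⟨pullPt ε '' C, ?_, Set.image_subset_iff.2 hCN, hCc.image (continuous_pullPt ε)⟩
  refine mem_of_superset ((isOpenMap_pullPt hψ).image_mem_nhds
    ((continuous_pullPt q).continuousAt hC)) ?_
  rintro _ ⟨y, hy, rfl⟩
  exact ⟨pullPt q y, hy, by rw [← pullPt_comp, hε]⟩

open Polynomial in
lemma LocallyCompactAt.pullPt_aeval_X_zero {n : ℕ} {a : MvPolynomial (Fin (n + 1)) K →ₐ[K] K}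
    (h : LocallyCompactAt a) :
    LocallyCompactAt (pullPt (aeval (MvPolynomial.X 0) :
      K[X] →ₐ[K] MvPolynomial (Fin (n + 1)) K) a) := by
  set π : K[X] →ₐ[K] MvPolynomial (Fin (n + 1)) K := aeval (MvPolynomial.X 0)
  let s : MvPolynomial (Fin (n + 1)) K →ₐ[K] K[X] :=
    MvPolynomial.aeval fun i ↦ if i = 0 then X else C (a (.X i))
  have hsπ : s.comp π = AlgHom.id K _ := Polynomial.algHom_ext (by simp [s, π])
  have hsa : pullPt s (pullPt π a) = a := MvPolynomial.algHom_ext fun i ↦ by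
    by_cases hi : i = 0
    · simp [s, π, hi]
    · simp only [pullPt_apply, s, MvPolynomial.aeval_X, if_neg hi]
      exact algHom_apply_C (pullPt π a) _
  intro N hN
  obtain ⟨C, hC, hCN, hCc⟩ := h _ ((continuous_pullPt π).continuousAt hN)
  refine ⟨pullPt π '' C, ?_, Set.image_subset_iff.2 hCN, hCc.image (continuous_pullPt π)⟩
  refine mem_of_superset ((continuous_pullPt s).continuousAt (x := pullPt π a)
    (by rwa [hsa])) fun y hy ↦ ?_
  exact ⟨pullPt s y, hy, by rw [← pullPt_comp, hsπ]; exact AlgHom.comp_id y⟩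

/-- The homeomorphism of the set of `K`-points induced by an isomorphism of algebras. -/
def pullPtHomeomorph (e : A ≃ₐ[K] B) : (B →ₐ[K] K) ≃ₜ (A →ₐ[K] K) where
  toFun := pullPt e.toAlgHom
  invFun := pullPt e.symm.toAlgHom
  left_inv x := by ext; simp
  right_inv x := by ext; simp
  continuous_toFun := continuous_pullPt _
  continuous_invFun := continuous_pullPt _

open Polynomial in
lemma locallyCompactSpace_line_of_locallyCompactAt {x : K[X] →ₐ[K] K} (h : LocallyCompactAt x) :
    LocallyCompactSpace (K[X] →ₐ[K] K) := by
  rw [locallyCompactSpace_iff_forall]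
  intro y
  let e := pullPtHomeomorph (Polynomial.algEquivAevalXAddC (x X - y X))
  rw [← e.isOpenEmbedding.locallyCompactAt_iff]
  convert h
  refine Polynomial.algHom_ext ?_
  simp [e, pullPtHomeomorph, algHom_apply_C]

open Polynomial in
/-- If an infinite set of points of an affine variety consists of points with compact
neighbourhood bases, then the affine line is locally compact. -/
theorem locallyCompactSpace_line_of_infinite [Algebra.FiniteType K A] {U : Set (A →ₐ[K] K)}
    (hU : U.Infinite) (hc : ∀ x ∈ U, LocallyCompactAt x) :
    LocallyCompactSpace (K[X] →ₐ[K] K) := by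
  have : IsNoetherianRing A := Algebra.FiniteType.isNoetherianRing K A
  obtain ⟨D, I, hDU, hD, hI, hDI⟩ := exists_prime_vanishing hU
  let q : A →ₐ[K] A ⧸ I := Ideal.Quotient.mkₐ K I
  have hq : Function.Surjective q := Ideal.Quotient.mk_surjective
  have hlift (x) (hx : x ∈ D) : ∃ y, pullPt q y = x :=
    ⟨Ideal.Quotient.liftₐ I x fun a ha ↦ (hDI a).1 ha x hx, by ext; rfl⟩
  have hD' : (pullPt q ⁻¹' D).Infinite := by
    refine Set.Infinite.of_image (pullPt q) ?_
    rwa [Set.image_preimage_eq_of_subset hlift]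
  have hDd (r : A ⧸ I) (hr : ∀ y ∈ pullPt q ⁻¹' D, y r = 0) : r = 0 := by
    obtain ⟨a, rfl⟩ := hq r
    refine Ideal.Quotient.eq_zero_iff_mem.2 ((hDI a).2 fun x hx ↦ ?_)
    obtain ⟨y, rfl⟩ := hlift x hx
    exact hr y hx
  obtain ⟨f, hf, n, ψ, hψ⟩ := exists_etale_mvPolynomial hD' hDd
  obtain ⟨a, rfl⟩ := hq f
  obtain ⟨y, hyD, hya⟩ : ∃ y ∈ pullPt q ⁻¹' D, y (q a) ≠ 0 := by
    by_contra! hcon; exact hf (hDd _ hcon)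
  obtain ⟨z, rfl⟩ := (range_pullPt_localizationAway (q a)).ge hya
  let q' : Localization.Away a →ₐ[K] Localization.Away (q a) := IsLocalization.Away.mapₐ _ _ q a
  have hq' : Function.Surjective q' := IsLocalization.Away.mapₐ_surjective_of_surjective a hq
  have h1 : LocallyCompactAt (pullPt q' z) := by
    rw [← (isOpenEmbedding_pullPt_localizationAway a).locallyCompactAt_iff, ← pullPt_comp]
    convert hc _ (hDU hyD) using 1
    rw [← pullPt_comp]
    congr 1
    ext b
    simp [q', IsLocalization.Away.mapₐ_apply, IsLocalization.Away.map]
  exact locallyCompactSpace_line_of_locallyCompactAt (h1.pullPt_of_etale hq' hψ).pullPt_aeval_X_zero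

open Polynomial in
/-- If the affine line is discrete, then so is every affine variety. -/
theorem discreteTopology_of_line [Algebra.FiniteType K A] [DiscreteTopology (K[X] →ₐ[K] K)] :
    DiscreteTopology (A →ₐ[K] K) := by
  obtain ⟨s, hs⟩ := (inferInstance : Algebra.FiniteType K A).out
  let F (x : A →ₐ[K] K) (a : s) : K[X] →ₐ[K] K := pullPt (aeval (a : A)) x
  have hF : Continuous F := continuous_pi fun a ↦ continuous_pullPt _
  refine DiscreteTopology.of_continuous_injective hF fun x y hxy ↦ ?_
  refine AlgHom.ext_of_adjoin_eq_top hs fun a ha ↦ ?_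
  simpa [F] using congr(($hxy ⟨a, ha⟩) X)

end LineOfVariety

section Varieties

variable {K : Type u} [Field K]

/-- The identification of the `K`-points of the affine line with `Hom(K[X], K)`. -/
def lineHomeomorph (K : Type u) [Field K] :
    (Polynomial K →ₐ[K] K) ≃ₜ Points (affineLine K) :=
  toPointHomeomorph K (Polynomial K)

lemma locallyCompactSpace_affineLine_iff :
    LocallyCompactSpace (Points (affineLine K)) ↔ LocallyCompactSpace (Polynomial K →ₐ[K] K) :=
  ⟨fun _ ↦ (lineHomeomorph K).isOpenEmbedding.locallyCompactSpace,
    fun _ ↦ (lineHomeomorph K).symm.isOpenEmbedding.locallyCompactSpace⟩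

lemma discreteTopology_affineLine_iff :
    DiscreteTopology (Points (affineLine K)) ↔ DiscreteTopology (Polynomial K →ₐ[K] K) :=
  ⟨fun _ ↦ (lineHomeomorph K).isEmbedding.discreteTopology,
    fun _ ↦ (lineHomeomorph K).symm.isEmbedding.discreteTopology⟩

theorem locallyCompactSpace_affineLine_of_variety {V : Over (Spec (CommRingCat.of K))}
    (hV : IsVariety V) {U : Set (Points V)} (hU : IsOpen U) (hUi : U.Infinite)
    (hUc : LocallyCompactSpace U) : LocallyCompactSpace (Points (affineLine K)) := by
  rw [locallyCompactSpace_affineLine_iff]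
  rw [locallyCompactSpace_subtype_iff hU] at hUc
  obtain ⟨ι, _, A, _, _, j, _, hj⟩ := exists_finite_charts hV
  let c (i : ι) (x : A i →ₐ[K] K) : Points V := Points.map (j i) (toPoint x)
  obtain ⟨i, hi⟩ : ∃ i, (c i ⁻¹' U).Infinite := by
    by_contra! hcon
    refine hUi ((Set.finite_iUnion fun i ↦ (hcon i).image (c i)).subset fun x hx ↦ ?_)
    obtain ⟨i, y, rfl⟩ := hj x
    exact Set.mem_iUnion.2 ⟨i, y, hx, rfl⟩
  have := finiteType_of_isOpenImmersion hV (j i)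
  exact locallyCompactSpace_line_of_infinite hi fun x hx ↦
    (isOpenEmbedding_map_toPoint (j i)).locallyCompactAt_iff.1 (hUc _ hx)

theorem discreteTopology_points_of_affineLine {V : Over (Spec (CommRingCat.of K))}
    (hV : IsVariety V) (h : DiscreteTopology (Points (affineLine K))) :
    DiscreteTopology (Points V) := by
  rw [discreteTopology_affineLine_iff] at h
  rw [discreteTopology_iff_isOpen_singleton]
  intro x
  obtain ⟨ι, _, A, _, _, j, _, hj⟩ := exists_finite_charts hV
  obtain ⟨i, y, rfl⟩ := hj x
  have := finiteType_of_isOpenImmersion hV (j i)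
  have : DiscreteTopology (A i →ₐ[K] K) := discreteTopology_of_line
  simpa using (isOpenEmbedding_map_toPoint (j i)).isOpenMap _ (isOpen_discrete {y})

lemma isVariety_affineLine : IsVariety (affineLine K) := isVariety_affineOver

open Polynomial in
lemma infinite_line [Infinite K] : Infinite (K[X] →ₐ[K] K) :=
  .of_injective (fun a : K ↦ (aeval a : K[X] →ₐ[K] K)) fun a b h ↦ by
    simpa using congr($h X)

lemma infinite_affineLine [Infinite K] : Infinite (Points (affineLine K)) :=
  have := infinite_line (K := K)
  (lineHomeomorph K).toEquiv.infinite_iff.1 this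

end Varieties

section Jacobian

/-- Inverting the Jacobian of `n` equations in `n` unknowns gives an étale algebra. -/
lemma etale_localizationAway_jacobian {R : Type u} [CommRing R] {n : ℕ}
    (v : Fin n → MvPolynomial (Fin n) R)
    (h : MvPolynomial (Fin n) R ⧸ Ideal.span (Set.range v)) :
    Algebra.Etale R (Localization.Away
      (Ideal.Quotient.mk (Ideal.span (Set.range v))
        (Matrix.of fun i j ↦ MvPolynomial.pderiv i (v j)).det * h)) := by
  let Q := MvPolynomial (Fin n) R ⧸ Ideal.span (Set.range v)
  let P : Algebra.PreSubmersivePresentation R Q (Fin n) (Fin n) :=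
    .naive id Function.injective_id
  have hP : P.jacobian = Ideal.Quotient.mk (Ideal.span (Set.range v))
      (Matrix.of fun i j ↦ MvPolynomial.pderiv i (v j)).det := by
    rw [P.jacobian_eq_jacobiMatrix_det]
    have : P.jacobiMatrix = Matrix.of fun i j ↦ MvPolynomial.pderiv i (v j) := by
      ext1 i j
      exact P.jacobiMatrix_apply i j
    rw [this]
    rfl
  rw [← hP]
  let S := Localization.Away (P.jacobian * h)
  let P' := (Algebra.PreSubmersivePresentation.localizationAway S (P.jacobian * h)).comp P
  have hu : IsUnit (algebraMap Q S (P.jacobian * h)) :=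
    IsLocalization.Away.algebraMap_isUnit (P.jacobian * h)
  let P'' : Algebra.SubmersivePresentation R S (Unit ⊕ Fin n) (Unit ⊕ Fin n) :=
    { P' with
      jacobian_isUnit := by
        rw [Algebra.PreSubmersivePresentation.comp_jacobian_eq_jacobian_smul_jacobian,
          Algebra.PreSubmersivePresentation.localizationAway_jacobian, Algebra.smul_def,
          IsUnit.mul_iff]
        exact ⟨isUnit_of_mul_isUnit_left (by rwa [map_mul] at hu), hu⟩ }
  rw [Algebra.Etale.iff_isStandardSmoothOfRelativeDimension_zero]
  exact P''.isStandardSmoothOfRelativeDimension (n := 0) (by simp [Algebra.Presentation.dimension])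

variable {K : Type u} [Field K] {A : Type u} [CommRing A] [Algebra K A]

/-- The set of points where a square system of polynomial equations has a solution with nonzero
Jacobian is étale-open. -/
lemma isOpen_exists_solution {n : ℕ} (w : Fin n → A) (F : Fin n → MvPolynomial (Fin n) K)
    (g : MvPolynomial (Fin n) K) :
    IsOpen {x : A →ₐ[K] K | ∃ a : Fin n → K, (∀ j, x (w j) = MvPolynomial.aeval a (F j)) ∧
      (Matrix.of fun i j ↦ MvPolynomial.aeval a (MvPolynomial.pderiv i (F j))).det ≠ 0 ∧
      MvPolynomial.aeval a g ≠ 0} := by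
  let v (j : Fin n) : MvPolynomial (Fin n) A :=
    MvPolynomial.map (algebraMap K A) (F j) - MvPolynomial.C (w j)
  let I := Ideal.span (Set.range v)
  let h : MvPolynomial (Fin n) A ⧸ I :=
    Ideal.Quotient.mk I (MvPolynomial.map (algebraMap K A) g)
  let d : MvPolynomial (Fin n) A := (Matrix.of fun i j ↦ MvPolynomial.pderiv i (v j)).det
  let B := Localization.Away (Ideal.Quotient.mk I d * h)
  have hB : Algebra.Etale A B := etale_localizationAway_jacobian v h
  have hev (x : A →ₐ[K] K) (a : Fin n → K) (p : MvPolynomial (Fin n) K) :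
      MvPolynomial.eval₂Hom x.toRingHom a (MvPolynomial.map (algebraMap K A) p) =
        MvPolynomial.aeval a p := by
    rw [MvPolynomial.coe_eval₂Hom, MvPolynomial.eval₂_map, MvPolynomial.aeval_def]
    congr 1
    exact x.comp_algebraMap
  have hevd (x : A →ₐ[K] K) (a : Fin n → K) : MvPolynomial.eval₂Hom x.toRingHom a d =
      (Matrix.of fun i j ↦ MvPolynomial.aeval a (MvPolynomial.pderiv i (F j))).det := by
    rw [RingHom.map_det]
    congr 1
    ext i j
    simp only [v, RingHom.mapMatrix_apply, Matrix.map_apply, Matrix.of_apply, map_sub,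
      MvPolynomial.pderiv_C, sub_zero, MvPolynomial.pderiv_map]
    exact hev x a _
  have hetale : (IsScalarTower.toAlgHom K A B).toRingHom.Etale :=
    (RingHom.etale_algebraMap (R := A) (S := B)).2 hB
  convert IsAlgEtaleImage.isOpen ⟨B, inferInstance, inferInstance, _, hetale, rfl⟩ using 1
  ext x
  constructor
  · rintro ⟨a, ha, hda, hga⟩
    let e : MvPolynomial (Fin n) A ⧸ I →+* K :=
      Ideal.Quotient.lift I (MvPolynomial.eval₂Hom x.toRingHom a) (by
        change I ≤ RingHom.ker _
        rw [Ideal.span_le]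
        rintro _ ⟨j, rfl⟩
        simp only [SetLike.mem_coe, RingHom.mem_ker, v, map_sub, hev]
        rw [MvPolynomial.coe_eval₂Hom, MvPolynomial.eval₂_C, sub_eq_zero]
        exact (ha j).symm)
    have hu : IsUnit (e (Ideal.Quotient.mk I d * h)) := by
      rw [map_mul, IsUnit.mul_iff]
      constructor
      · change IsUnit (MvPolynomial.eval₂Hom x.toRingHom a d)
        rw [hevd]
        exact IsUnit.mk0 _ hda
      · change IsUnit (MvPolynomial.eval₂Hom x.toRingHom a _)
        rw [hev]
        exact IsUnit.mk0 _ hga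
    let e' : B →+* K := IsLocalization.Away.lift _ hu
    have he' (b : A) : e' (algebraMap A B b) = x b := by
      rw [IsScalarTower.algebraMap_apply A (MvPolynomial (Fin n) A ⧸ I) B]
      rw [IsLocalization.Away.lift_eq]
      change MvPolynomial.eval₂Hom x.toRingHom a (MvPolynomial.C b) = _
      simp
    refine ⟨⟨e', fun k ↦ ?_⟩, ?_⟩
    · change e' (algebraMap K B k) = _
      rw [IsScalarTower.algebraMap_apply K A B, he']
      exact x.commutes k
    · ext b
      exact he' b
  · rintro ⟨y, rfl⟩
    let f : MvPolynomial (Fin n) A →ₐ[K] K := (y.comp (IsScalarTower.toAlgHom K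
      (MvPolynomial (Fin n) A ⧸ I) B)).comp (Ideal.Quotient.mkₐ K I)
    have hf : f.toRingHom = MvPolynomial.eval₂Hom
        (pullPt (IsScalarTower.toAlgHom K A B) y).toRingHom (fun i ↦ f (.X i)) := by
      refine MvPolynomial.ringHom_ext (fun b ↦ ?_) fun i ↦ ?_
      · rw [MvPolynomial.eval₂Hom_C]
        rfl
      · rw [MvPolynomial.eval₂Hom_X']
        rfl
    have hu : IsUnit (y (algebraMap (MvPolynomial (Fin n) A ⧸ I) B (Ideal.Quotient.mk I d * h))) :=
      (IsLocalization.Away.algebraMap_isUnit (S := B) _).map y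
    rw [map_mul, map_mul, IsUnit.mul_iff] at hu
    refine ⟨fun i ↦ f (.X i), fun j ↦ ?_, ?_, ?_⟩
    · have h0 : f.toRingHom (v j) = 0 := by
        change y (algebraMap (MvPolynomial (Fin n) A ⧸ I) B (Ideal.Quotient.mk I (v j))) = 0
        have hj : v j ∈ I := Ideal.subset_span (Set.mem_range_self j)
        rw [Ideal.Quotient.eq_zero_iff_mem.2 hj, map_zero, map_zero]
      rw [hf] at h0
      simp only [v, map_sub, hev, MvPolynomial.eval₂Hom_C] at h0
      exact (sub_eq_zero.1 h0).symm
    · rw [← hevd (pullPt (IsScalarTower.toAlgHom K A B) y), ← hf]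
      exact hu.1.ne_zero
    · rw [← hev (pullPt (IsScalarTower.toAlgHom K A B) y), ← hf]
      exact hu.2.ne_zero

open Polynomial in
/-- The étale-open image of a one-variable polynomial map away from its critical points. -/
lemma isOpen_exists_eval_eq (f : K[X]) :
    IsOpen {x : K[X] →ₐ[K] K | ∃ a : K, x X = f.eval a ∧ f.derivative.eval a ≠ 0} := by
  let F : MvPolynomial (Fin 1) K := aeval (MvPolynomial.X 0) f
  have hF (p : K[X]) (a : Fin 1 → K) :
      MvPolynomial.aeval a (aeval (MvPolynomial.X 0 : MvPolynomial (Fin 1) K) p) = p.eval (a 0) := by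
    rw [← Polynomial.aeval_algHom_apply, MvPolynomial.aeval_X, Polynomial.coe_aeval_eq_eval]
  have hF' : MvPolynomial.pderiv 0 F = aeval (MvPolynomial.X 0) f.derivative := by
    rw [Derivation.map_aeval, MvPolynomial.pderiv_X_self, smul_eq_mul, mul_one]
  convert isOpen_exists_solution (A := K[X]) (fun _ : Fin 1 ↦ X) (fun _ ↦ F) 1 using 1
  ext x
  constructor
  · rintro ⟨a, ha, ha'⟩
    refine ⟨fun _ ↦ a, fun _ ↦ by rw [hF]; exact ha, ?_, by simp⟩
    rw [Matrix.det_fin_one, Matrix.of_apply, hF', hF]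
    exact ha'
  · rintro ⟨a, ha, ha', -⟩
    rw [Matrix.det_fin_one, Matrix.of_apply, hF', hF] at ha'
    exact ⟨a 0, by rw [ha 0, hF], ha'⟩

end Jacobian

section Hausdorff

variable {K : Type u} [Field K]

/-- A polynomial over a finite extension splits into coordinates with respect to a basis. -/
lemma exists_coordinates {L ι σ : Type*} [Field L] [Algebra K L] [Fintype ι]
    (b : Module.Basis ι K L) (G : MvPolynomial σ L) :
    ∃ F : ι → MvPolynomial σ K,
      G = ∑ j, MvPolynomial.C (b j) * MvPolynomial.map (algebraMap K L) (F j) := by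
  induction G using MvPolynomial.induction_on with
  | C c =>
    refine ⟨fun j ↦ MvPolynomial.C (b.repr c j), ?_⟩
    conv_lhs => rw [← b.sum_repr c, map_sum]
    refine Finset.sum_congr rfl fun j _ ↦ ?_
    rw [MvPolynomial.map_C, ← map_mul, Algebra.smul_def, mul_comm]
  | add p q hp hq =>
    obtain ⟨F, hF⟩ := hp
    obtain ⟨F', hF'⟩ := hq
    exact ⟨fun j ↦ F j + F' j, by
      simp only [map_add, mul_add, Finset.sum_add_distrib]; rw [← hF, ← hF']⟩
  | mul_X p i hp =>
    obtain ⟨F, hF⟩ := hp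
    exact ⟨fun j ↦ F j * .X i, by
      simp only [map_mul, MvPolynomial.map_X, ← mul_assoc, ← Finset.sum_mul]; rw [← hF]⟩

end Hausdorff

section Separation

variable {K : Type u} [Field K]

open Polynomial in
/-- If the powers `1, θ, …, θ ^ (n - 1)` are linearly independent, then `θ` satisfies no nontrivial
equation of degree less than `n`. -/
lemma eq_zero_of_aeval_eq_zero_of_det_ne_zero {L : Type*} [Field L] [Algebra K L] {n : ℕ}
    (b : Module.Basis (Fin n) K L) {θ : L} {M : Matrix (Fin n) (Fin n) K} (hM : M.det ≠ 0)
    (hθ : ∀ k : Fin n, θ ^ (k : ℕ) = ∑ j, M k j • b j) {q : K[X]} (hq : q.natDegree < n)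
    (h : aeval θ q = 0) : q = 0 := by
  have h1 : Matrix.vecMul (fun k : Fin n ↦ q.coeff k) M = 0 := by
    funext j
    have h2 : ∑ j, (∑ k : Fin n, q.coeff k * M k j) • b j = 0 := by
      rw [← h, aeval_eq_sum_range' hq, Finset.sum_range]
      simp_rw [hθ, Finset.sum_smul, Finset.smul_sum, smul_smul]
      exact Finset.sum_comm
    exact Fintype.linearIndependent_iff.1 b.linearIndependent _ h2 j
  have h3 := Matrix.eq_zero_of_vecMul_eq_zero hM h1
  ext k
  by_cases hk : k < n
  · exact congr_fun h3 ⟨k, hk⟩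
  · rw [coeff_eq_zero_of_natDegree_lt (hq.trans_le (not_lt.1 hk)), coeff_zero]

open Polynomial in
/-- If `f` is irreducible and separable without roots, the values of `f` near which `f - t`
remains irreducible contain an étale-open neighbourhood of `0`. -/
lemma exists_isOpen_disjoint_values {f : K[X]} (hm : f.Monic) (hi : Irreducible f)
    (hs : f.Separable) (hr : ∀ c, f.eval c ≠ 0) :
    ∃ O : Set (K[X] →ₐ[K] K), IsOpen O ∧ (aeval (0 : K) : K[X] →ₐ[K] K) ∈ O ∧
      ∀ x ∈ O, ∀ c, x X ≠ f.eval c := by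
  have := Fact.mk hi
  let L := AdjoinRoot f
  let n := f.natDegree
  let b : Module.Basis (Fin n) K L := (AdjoinRoot.powerBasis' hm).basis
  have hb (i : Fin n) : b i = AdjoinRoot.root f ^ (i : ℕ) := by
    exact (AdjoinRoot.powerBasis' hm).basis_eq_pow i
  have hn : 1 < n := by
    by_contra hn
    obtain ⟨c, hc⟩ := exists_root_of_degree_eq_one
      ((degree_eq_iff_natDegree_eq_of_pos (p := f) one_pos).2 (by have := hi.natDegree_pos; lia))
    exact hr c hc
  let Θ : MvPolynomial (Fin n) L := ∑ i, MvPolynomial.C (b i) * .X i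
  obtain ⟨F, hF⟩ := exists_coordinates b (aeval Θ f)
  have hH (k : Fin n) := exists_coordinates b (Θ ^ (k : ℕ))
  choose H hH using hH
  let ev (a : Fin n → K) : MvPolynomial (Fin n) L →ₐ[L] L :=
    MvPolynomial.aeval fun i ↦ algebraMap K L (a i)
  let θ (a : Fin n → K) : L := ∑ i, a i • b i
  have hev (a p) : ev a (MvPolynomial.map (algebraMap K L) p) =
      algebraMap K L (MvPolynomial.aeval a p) := by
    simp only [ev]
    rw [MvPolynomial.aeval_map_algebraMap, ← MvPolynomial.aeval_algebraMap_apply]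
    rfl
  have hevs (a) (P : Fin n → MvPolynomial (Fin n) K) :
      ev a (∑ j, MvPolynomial.C (b j) * MvPolynomial.map (algebraMap K L) (P j)) =
        ∑ j, MvPolynomial.aeval a (P j) • b j := by
    rw [map_sum]
    refine Finset.sum_congr rfl fun j _ ↦ ?_
    rw [map_mul, hev, Algebra.smul_def, mul_comm]
    congr 1
    simp [ev]
  have hΘ (a) : ev a Θ = θ a := by
    simp only [Θ, θ, map_sum, map_mul]
    refine Finset.sum_congr rfl fun j _ ↦ ?_
    rw [Algebra.smul_def, mul_comm]
    simp [ev]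
  have hfΘ (a) (p : K[X]) : ev a (aeval Θ p) = aeval (θ a) p := by
    rw [← hΘ]
    exact (Polynomial.aeval_algHom_apply ((ev a).restrictScalars K) Θ p).symm
  have hpow (a) (k : Fin n) : θ a ^ (k : ℕ) = ∑ j, MvPolynomial.aeval a (H k j) • b j := by
    rw [← hevs, ← hH, map_pow, hΘ]
  have hval (a) : aeval (θ a) f = ∑ j, MvPolynomial.aeval a (F j) • b j := by
    rw [← hevs, ← hF, hfΘ]
  have hder (a i) : aeval (θ a) f.derivative * b i =
      ∑ j, MvPolynomial.aeval a (MvPolynomial.pderiv i (F j)) • b j := by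
    rw [← hevs]
    have h1 : MvPolynomial.pderiv i (aeval Θ f) = aeval Θ f.derivative * MvPolynomial.C (b i) := by
      have h2 := ((MvPolynomial.pderiv i :
        Derivation L (MvPolynomial (Fin n) L) _).restrictScalars K).map_aeval f Θ
      have h3 : MvPolynomial.pderiv i Θ = MvPolynomial.C (b i) := by
        simp only [Θ, map_sum, MvPolynomial.pderiv_C_mul, MvPolynomial.pderiv_X]
        rw [Finset.sum_eq_single i]
        · simp
        · intro j _ hj
          simp [hj]
        · simp
      rw [← h3]
      exact h2
    rw [← hfΘ, show b i = ev a (MvPolynomial.C (b i)) by simp [ev], ← map_mul, ← h1, hF, map_sum]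
    simp_rw [MvPolynomial.pderiv_C_mul, MvPolynomial.pderiv_map]
  let g : MvPolynomial (Fin n) K := (Matrix.of H).det
  have hg (a : Fin n → K) : MvPolynomial.aeval a g =
      (Matrix.of fun k j ↦ MvPolynomial.aeval a (H k j)).det := by
    rw [AlgHom.map_det]
    rfl
  let j₀ : Fin n := ⟨0, by lia⟩
  have hb₀ : b j₀ = 1 := by rw [hb]; exact pow_zero _
  let w (j : Fin n) : K[X] := if j = j₀ then X else 0
  have hw (x : K[X] →ₐ[K] K) : ∑ j, x (w j) • b j = algebraMap K L (x X) := by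
    rw [Finset.sum_eq_single j₀]
    · simp [w, hb₀, Algebra.smul_def]
    · intro j _ hj
      simp [w, hj]
    · simp
  refine ⟨_, isOpen_exists_solution w F g, ?_, ?_⟩
  · let a : Fin n → K := b.repr (AdjoinRoot.root f)
    have ha : θ a = AdjoinRoot.root f := b.sum_repr _
    have hF0 (j) : MvPolynomial.aeval a (F j) = 0 := by
      refine Fintype.linearIndependent_iff.1 b.linearIndependent
        (fun j ↦ MvPolynomial.aeval a (F j)) ?_ j
      rw [← hval, ha]
      exact AdjoinRoot.eval₂_root f
    have hd : aeval (θ a) f.derivative ≠ 0 :=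
      hs.aeval_derivative_ne_zero (by rw [hval]; simp [hF0])
    refine ⟨a, fun j ↦ ?_, ?_, ?_⟩
    · rw [hF0]
      by_cases hj : j = j₀ <;> simp [w, hj]
    · intro hdet
      obtain ⟨c, hc0, hc⟩ := Matrix.exists_vecMul_eq_zero_iff.2 hdet
      apply hc0
      have h1 : ∑ i, c i • (aeval (θ a) f.derivative * b i) = 0 := by
        simp_rw [hder, Finset.smul_sum, smul_smul]
        rw [Finset.sum_comm]
        refine Finset.sum_eq_zero fun j _ ↦ ?_
        rw [← Finset.sum_smul]
        have := congr_fun hc j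
        simp only [Matrix.vecMul, dotProduct, Matrix.of_apply, Pi.zero_apply] at this
        rw [this, zero_smul]
      simp_rw [← mul_smul_comm] at h1
      rw [← Finset.mul_sum, mul_eq_zero] at h1
      funext i
      exact Fintype.linearIndependent_iff.1 b.linearIndependent _ (h1.resolve_left hd) i
    · rw [hg]
      have : (Matrix.of fun k j ↦ MvPolynomial.aeval a (H k j)) = 1 := by
        ext k j
        have h1 := congr(b.repr $(hpow a k) j)
        rw [ha, ← hb, b.repr_self, b.repr_sum_self] at h1
        rw [Matrix.of_apply, ← h1, Matrix.one_apply, Finsupp.single_apply]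
      rw [this, Matrix.det_one]
      exact one_ne_zero
  · rintro x ⟨a, ha, -, hga⟩ c hc
    rw [hg] at hga
    have hroot : aeval (θ a) (f - C (f.eval c)) = 0 := by
      rw [map_sub, hval, aeval_C, ← hc, ← hw, sub_eq_zero]
      exact Finset.sum_congr rfl fun j _ ↦ by rw [ha]
    have key {q : K[X]} (hq : q.natDegree < n) (h0 : aeval (θ a) q = 0) : q = 0 :=
      eq_zero_of_aeval_eq_zero_of_det_ne_zero b hga (hpow a) hq h0
    have hdeg : (f - C (f.eval c)).natDegree = n := natDegree_sub_C
    obtain ⟨q, hq⟩ : X - C c ∣ f - C (f.eval c) := by rw [dvd_iff_isRoot]; simp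
    have hne : f - C (f.eval c) ≠ 0 := fun h ↦ by rw [h, natDegree_zero] at hdeg; lia
    have hq0 : q ≠ 0 := by rintro rfl; simp [hq] at hne
    rw [hq, natDegree_mul (X_sub_C_ne_zero c) hq0, natDegree_X_sub_C] at hdeg
    rw [hq, map_mul, mul_eq_zero] at hroot
    rcases hroot with h | h
    · exact X_sub_C_ne_zero c (key (by rwa [natDegree_X_sub_C]) h)
    · exact hq0 (key (by lia) h)

open Polynomial in
/-- The map on the line induced by `X ↦ α X + β`. -/
lemma pullPt_affine (α β : K) (x : K[X] →ₐ[K] K) :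
    pullPt (aeval (C α * X + C β) : K[X] →ₐ[K] K[X]) x X = α * x X + β := by
  simp [algHom_apply_C]

open Polynomial in
lemma exists_irreducible_of_not_isSepClosed (hK : ¬ IsSepClosed K) :
    ∃ f : K[X], f.Monic ∧ Irreducible f ∧ f.Separable ∧ ∀ c, f.eval c ≠ 0 := by
  by_contra! h
  exact hK (.of_exists_root _ fun p h1 h2 h3 ↦ h p h1 h2 h3)

open Polynomial in
lemma exists_derivative_eval_ne_zero [Infinite K] {f : K[X]} (hi : Irreducible f)
    (hs : f.Separable) : ∃ c, f.derivative.eval c ≠ 0 := by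
  by_contra! h
  have h0 : f.derivative = 0 := Polynomial.funext fun c ↦ by rw [h, eval_zero]
  rw [Polynomial.Separable, h0, isCoprime_zero_right] at hs
  exact hi.not_isUnit hs

open Polynomial in
/-- The étale-open topology on the line over a field which is not separably closed is Hausdorff. -/
theorem t2Space_line [Infinite K] (hK : ¬ IsSepClosed K) : T2Space (K[X] →ₐ[K] K) := by
  obtain ⟨f, hm, hi, hs, hr⟩ := exists_irreducible_of_not_isSepClosed hK
  obtain ⟨O, hO, h0, hOf⟩ := exists_isOpen_disjoint_values hm hi hs hr
  obtain ⟨c, hc⟩ := exists_derivative_eval_ne_zero hi hs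
  refine ⟨fun x y hxy ↦ ?_⟩
  have hxy' : y X - x X ≠ 0 := fun h ↦ hxy (Polynomial.algHom_ext (sub_eq_zero.1 h).symm)
  let α := f.eval c / (y X - x X)
  let φ : K[X] →ₐ[K] K[X] := aeval (C α * X + C (-(α * x X)))
  refine ⟨_, _, hO.preimage (continuous_pullPt φ),
    (isOpen_exists_eval_eq f).preimage (continuous_pullPt φ), ?_, ?_, ?_⟩
  · change pullPt φ x ∈ O
    convert h0
    refine Polynomial.algHom_ext ?_
    rw [pullPt_affine]
    simp
  · refine ⟨c, ?_, hc⟩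
    rw [pullPt_affine, ← sub_eq_add_neg, ← mul_sub]
    exact div_mul_cancel₀ _ hxy'
  · rw [Set.disjoint_left]
    rintro z hz ⟨c', hc', -⟩
    exact hOf _ hz c' hc'

end Separation

section SeparatelyContinuous

variable {K : Type*} [Field K] [TopologicalSpace K] [T2Space K] [LocallyCompactSpace K]

lemma continuousAdd_of_separately (hadd : ∀ a : K, Continuous fun x ↦ a + x)
    (hneg : Continuous fun x : K ↦ -x) : ContinuousAdd K := by
  refine ⟨continuous_iff_continuousAt.2 fun ⟨a, b⟩ ↦ ?_⟩
  have h (c : K) : Tendsto (fun x ↦ -c + x) (𝓝 c) (𝓝 0) := by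
    simpa using (hadd (-c)).tendsto c
  have h1 := (tendsto_add_zero_of_separately hadd hneg).comp ((h a).prodMap (h b))
  have h2 := ((hadd (a + b)).tendsto 0).comp h1
  rw [add_zero, ← nhds_prod_eq] at h2
  refine h2.congr fun p ↦ ?_
  simp only [Function.comp_apply, Prod.map_fst, Prod.map_snd]
  ring

/-- A locally compact Hausdorff topology on a field for which translations, homotheties and
inversion are continuous is a field topology. -/
theorem isTopologicalDivisionRing_of_separately (hadd : ∀ a : K, Continuous fun x ↦ a + x)
    (hmul : ∀ a : K, Continuous fun x ↦ a * x) (hinv : ∀ a : K, a ≠ 0 → ContinuousAt Inv.inv a) :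
    IsTopologicalDivisionRing K := by
  have hneg : Continuous fun x : K ↦ -x := by simpa using hmul (-1)
  have := continuousAdd_of_separately hadd hneg
  let _ : TopologicalSpace Kˣ := .induced Units.val ‹_›
  have hval : IsOpenEmbedding (Units.val : Kˣ → K) := by
    refine ⟨⟨⟨rfl⟩, Units.val_injective⟩, ?_⟩
    rw [show Set.range (Units.val : Kˣ → K) = {0}ᶜ by
      ext x; exact ⟨by rintro ⟨y, rfl⟩; exact y.ne_zero, fun hx ↦ ⟨Units.mk0 x hx, rfl⟩⟩]
    exact isOpen_compl_singleton
  have : T2Space Kˣ := hval.isEmbedding.t2Space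
  have : LocallyCompactSpace Kˣ := hval.locallyCompactSpace
  have hone := tendsto_mul_one_of_separately (G := Kˣ)
    (fun a ↦ hval.isInducing.continuous_iff.2 ((hmul a).comp hval.continuous))
    (hval.isInducing.continuous_iff.2 (continuous_iff_continuousAt.2 fun x ↦ by
      have : ContinuousAt (fun y : Kˣ ↦ (y : K)⁻¹) x :=
        (hinv x x.ne_zero).comp hval.continuous.continuousAt
      refine this.congr (.of_forall fun y ↦ (Units.val_inv_eq_inv_val y).symm)))
  have hone' : Tendsto (fun p : K × K ↦ p.1 * p.2) (𝓝 1 ×ˢ 𝓝 1) (𝓝 1) := by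
    rw [← Units.val_one, ← hval.map_nhds_eq, prod_map_map_eq, tendsto_map'_iff]
    exact tendsto_map.comp hone
  have hmul' (a : K) : Continuous fun x ↦ x * a := by simpa only [mul_comm] using hmul a
  have : ContinuousMul K := by
    refine ⟨continuous_iff_continuousAt.2 fun ⟨a, b⟩ ↦ ?_⟩
    have h (c : K) : Tendsto (fun x ↦ (1 + -c) + x) (𝓝 c) (𝓝 1) := by
      simpa using (hadd (1 + -c)).tendsto c
    have h1 := hone'.comp ((h a).prodMap (h b))
    rw [← nhds_prod_eq] at h1
    have h2 : Continuous fun p : K × K ↦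
        (a + -1) * p.2 + (p.1 * (b + -1) + (a + b + -(a * b) + -1)) :=
      ((hmul _).comp continuous_snd).add (((hmul' _).comp continuous_fst).add continuous_const)
    have h3 := h1.add (h2.tendsto (a, b))
    have h4 : 1 + ((a + -1) * b + (a * (b + -1) + (a + b + -(a * b) + -1))) = a * b := by ring
    rw [h4] at h3
    refine h3.congr fun p ↦ ?_
    simp only [Function.comp_apply, Prod.map_fst, Prod.map_snd]
    ring
  exact { toContinuousAdd := ‹_›, toContinuousMul := ‹_›, continuous_neg := hneg,
          continuousAt_inv₀ := fun {a} ha ↦ hinv a ha }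

end SeparatelyContinuous

section LineTopology

variable {K : Type u} [Field K]

open Polynomial in
/-- The `K`-points of the affine line are the elements of `K`. -/
def lineEquiv (K : Type u) [Field K] : K ≃ (K[X] →ₐ[K] K) where
  toFun a := aeval a
  invFun x := x X
  left_inv a := by simp
  right_inv x := Polynomial.algHom_ext (by simp)

open Polynomial in
lemma pullPt_lineEquiv (p : K[X]) (a : K) :
    pullPt (aeval p : K[X] →ₐ[K] K[X]) (lineEquiv K a) = lineEquiv K (p.eval a) :=
  Polynomial.algHom_ext (by simp [lineEquiv, Polynomial.coe_aeval_eq_eval])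

open Polynomial in
/-- Inversion is étale-open continuous on the punctured line. -/
lemma isOpen_inv_mem {W : Set (K[X] →ₐ[K] K)} (hW : IsOpen W) :
    IsOpen {x : K[X] →ₐ[K] K | x X ≠ 0 ∧ lineEquiv K (x X)⁻¹ ∈ W} := by
  let l := IsScalarTower.toAlgHom K K[X] (Localization.Away (X : K[X]))
  let φ : K[X] →ₐ[K] Localization.Away (X : K[X]) :=
    aeval (IsLocalization.Away.invSelf (X : K[X]))
  have hφ (z : Localization.Away (X : K[X]) →ₐ[K] K) :
      pullPt φ z = lineEquiv K (pullPt l z X)⁻¹ := by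
    refine Polynomial.algHom_ext ?_
    have h := congr(z $(IsLocalization.Away.mul_invSelf (S := Localization.Away (X : K[X])) (X : K[X])))
    rw [map_mul, map_one] at h
    simp only [φ, lineEquiv, pullPt_apply, aeval_X, Equiv.coe_fn_mk, l,
      IsScalarTower.coe_toAlgHom']
    exact eq_inv_of_mul_eq_one_right h
  convert isOpenMap_pullPt (etale_toLocalizationAway (X : K[X])) _
    (hW.preimage (continuous_pullPt φ)) using 1
  ext x
  constructor
  · rintro ⟨hx, hxW⟩
    obtain ⟨z, rfl⟩ := (range_pullPt_localizationAway (K := K) (X : K[X])).ge hx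
    exact ⟨z, by rw [Set.mem_preimage, hφ]; exact hxW, rfl⟩
  · rintro ⟨z, hz, rfl⟩
    exact ⟨(range_pullPt_localizationAway (K := K) (X : K[X])).le ⟨z, rfl⟩,
      by rw [Set.mem_preimage, hφ] at hz; exact hz⟩

open Polynomial in
theorem isLocalField_of_line [Infinite K] (hK : ¬ IsSepClosed K)
    [LocallyCompactSpace (K[X] →ₐ[K] K)] (hd : ¬ DiscreteTopology (K[X] →ₐ[K] K)) :
    IsLocalField K := by
  have := t2Space_line hK
  let τ : TopologicalSpace K := .induced (lineEquiv K) inferInstance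
  let e : K ≃ₜ (K[X] →ₐ[K] K) := (lineEquiv K).toHomeomorphOfIsInducing ⟨rfl⟩
  have : T2Space K := e.symm.t2Space
  have : LocallyCompactSpace K := e.isOpenEmbedding.locallyCompactSpace
  have hp (p : K[X]) : Continuous fun x ↦ p.eval x := by
    rw [e.isInducing.continuous_iff]
    exact ((continuous_pullPt (aeval p : K[X] →ₐ[K] K[X])).comp e.continuous).congr
      fun x ↦ pullPt_lineEquiv p x
  refine ⟨τ, isTopologicalDivisionRing_of_separately (fun a ↦ ?_) (fun a ↦ ?_) (fun a ha ↦ ?_),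
    ‹_›, ‹_›, fun h ↦ hd e.symm.isEmbedding.discreteTopology⟩
  · exact (hp (C a + X)).congr fun x ↦ by rw [eval_add, eval_C, eval_X]
  · exact (hp (C a * X)).congr fun x ↦ by rw [eval_mul, eval_C, eval_X]
  · intro W hW
    obtain ⟨W', hW'W, hW', haW'⟩ := mem_nhds_iff.1 hW
    have h1 := (isOpen_inv_mem (e.isOpenMap _ hW')).preimage e.continuous
    rw [mem_map]
    refine mem_of_superset (h1.mem_nhds (x := a) ?_) ?_
    · simp only [Set.mem_preimage, Set.mem_ofPred_eq]
      have : e a X = a := (lineEquiv K).symm_apply_apply a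
      rw [this]
      exact ⟨ha, a⁻¹, haW', rfl⟩
    · rintro x ⟨-, y, hy, hxy⟩
      have h2 : e x X = x := (lineEquiv K).symm_apply_apply x
      have h3 : y = x⁻¹ := by rw [h2] at hxy; exact (lineEquiv K).injective hxy
      exact hW'W (h3 ▸ hy)

end LineTopology

section LocallyCompactField

variable {K : Type*} [Field K] [TopologicalSpace K] [IsTopologicalDivisionRing K]

lemma eventually_forall_mul_mem {C U : Set K} (hC : IsCompact C) (hU : IsOpen U) {x : K}
    (h : ∀ y ∈ C, x * y ∈ U) : ∀ᶠ z in 𝓝 x, ∀ y ∈ C, z * y ∈ U :=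
  hC.eventually_forall_of_forall_eventually fun y hy ↦
    (continuous_mul.continuousAt (x := (x, y))).eventually_mem (hU.mem_nhds (h y hy))

lemma neBot_punctured_nhds_zero (hd : ¬ DiscreteTopology K) : (𝓝[≠] (0 : K)).NeBot := by
  by_contra h
  exact hd (discreteTopology_of_isOpen_singleton_zero
    ((isOpen_singleton_iff_punctured_nhds 0).2 (not_neBot.1 h)))

/-- Nonzero elements exist in any neighbourhood of zero. -/
lemma exists_ne_zero_of_eventually (hd : ¬ DiscreteTopology K) {p : K → Prop}
    (hp : ∀ᶠ x in 𝓝 (0 : K), p x) : ∃ x, x ≠ 0 ∧ p x := by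
  have := neBot_punctured_nhds_zero hd
  obtain ⟨x, hx, hx0⟩ := ((hp.filter_mono nhdsWithin_le_nhds).and
    (self_mem_nhdsWithin : {(0 : K)}ᶜ ∈ 𝓝[≠] 0)).exists
  exact ⟨x, hx0, hx⟩

variable [T2Space K] [LocallyCompactSpace K]

open MeasureTheory Measure Pointwise in
/-- A nondiscrete locally compact field carries a continuous multiplicative function vanishing only
at zero: the factor by which multiplication scales a Haar measure. -/
lemma exists_modulus (hd : ¬ DiscreteTopology K) :
    ∃ m : K → ℝ, Continuous m ∧ (∀ x y, m (x * y) = m x * m y) ∧ (∀ x, m x = 0 ↔ x = 0) ∧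
      ∀ x, 0 ≤ m x := by
  classical
  borelize K
  have := neBot_punctured_nhds_zero hd
  let μ : Measure K := addHaar
  obtain ⟨C, hC, h0C⟩ := exists_compact_mem_nhds (0 : K)
  have hμ0 : μ C ≠ 0 := (measure_pos_of_mem_nhds μ h0C).ne'
  have hμt : μ C ≠ ⊤ := hC.measure_lt_top.ne
  let m (x : K) : NNReal := if hx : x = 0 then 0 else distribHaarChar K (Units.mk0 x hx)
  have hm0 (x) : m x = 0 ↔ x = 0 := by
    constructor
    · intro h
      by_contra hx
      simp only [m, dif_neg hx] at h
      exact distribHaarChar_pos.ne' h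
    · rintro rfl
      simp [m]
  have hmul (x y) : m (x * y) = m x * m y := by
    by_cases hx : x = 0
    · simp [m, hx]
    by_cases hy : y = 0
    · simp [m, hy]
    simp only [m, dif_neg hx, dif_neg hy, dif_neg (mul_ne_zero hx hy), ← map_mul]
    congr 1
    ext
    simp
  have hm1 : m 1 = 1 := by
    have h1 := hmul 1 1
    rw [mul_one] at h1
    exact (mul_eq_left₀ (mt (hm0 1).1 one_ne_zero)).1 h1.symm
  have hμ (x) : (m x : ENNReal) * μ C = μ ((fun y ↦ x * y) '' C) := by
    by_cases hx : x = 0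
    · have : (fun y ↦ x * y) '' C = {0} := by
        rw [hx]
        ext z
        simp only [zero_mul, Set.mem_image, Set.mem_singleton_iff]
        exact ⟨fun ⟨_, _, h⟩ ↦ h.symm, fun h ↦ ⟨0, mem_of_mem_nhds h0C, h.symm⟩⟩
      rw [this, (hm0 x).2 hx, measure_singleton]
      simp
    · simp only [m, dif_neg hx]
      exact distribHaarChar_mul μ (Units.mk0 x hx) C
  have husc (x : K) (r : NNReal) (hr : m x < r) : ∀ᶠ z in 𝓝 x, m z < r := by
    have h1 : μ ((fun y ↦ x * y) '' C) < r * μ C := by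
      rw [← hμ]
      exact ENNReal.mul_lt_mul_left hμ0 hμt (by exact_mod_cast hr)
    obtain ⟨U, hUC, hU, hUr⟩ := Set.exists_isOpen_lt_of_lt _ _ h1
    filter_upwards [eventually_forall_mul_mem hC hU fun y hy ↦ hUC ⟨y, hy, rfl⟩] with z hz
    have h2 : (m z : ENNReal) * μ C < r * μ C := by
      rw [hμ]
      refine (measure_mono ?_).trans_lt hUr
      rintro _ ⟨y, hy, rfl⟩
      exact hz y hy
    exact_mod_cast lt_of_mul_lt_mul_right' h2
  have hcont : Continuous m := by
    rw [continuous_iff_continuousAt]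
    intro x
    refine tendsto_order.2 ⟨fun r hr ↦ ?_, fun r hr ↦ husc x r hr⟩
    have hx : x ≠ 0 := fun hx ↦ by rw [(hm0 x).2 hx] at hr; exact not_lt_zero hr
    obtain ⟨r', hr', hr'x⟩ := exists_between hr
    have hr0 : 0 < r' := bot_le.trans_lt hr'
    have hinv (z : K) (hz : z ≠ 0) : m z⁻¹ = (m z)⁻¹ :=
      eq_inv_of_mul_eq_one_left (by rw [← hmul, inv_mul_cancel₀ hz, hm1])
    have h1 : m x⁻¹ < r'⁻¹ := by
      rw [hinv x hx]
      exact inv_strictAnti₀ hr0 hr'x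
    have h2 := (continuousAt_inv₀ hx).eventually (husc x⁻¹ _ h1)
    filter_upwards [h2, isOpen_ne.mem_nhds hx] with z hz hz0
    rw [hinv z hz0] at hz
    exact hr'.trans ((inv_lt_inv₀ (pos_iff_ne_zero.2 (mt (hm0 z).1 hz0)) hr0).1 hz)
  exact ⟨fun x ↦ m x, NNReal.continuous_coe.comp hcont, fun x y ↦ congr(NNReal.toReal $(hmul x y)),
    fun x ↦ by simpa using hm0 x, fun x ↦ (m x).2⟩

lemma exists_tendsto_pow_zero (hd : ¬ DiscreteTopology K) :
    ∃ c : K, c ≠ 0 ∧ Tendsto (fun n : ℕ ↦ c ^ n) atTop (𝓝 0) := by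
  obtain ⟨m, hmc, hmul, hm0, hmn⟩ := exists_modulus hd
  obtain ⟨C₀, hC₀, h0C₀⟩ := exists_compact_mem_nhds (0 : K)
  let C := insert 1 C₀
  have hC : IsCompact C := hC₀.insert 1
  have h0C : C ∈ 𝓝 (0 : K) := mem_of_superset h0C₀ (Set.subset_insert _ _)
  have h1 : ∀ᶠ c in 𝓝 (0 : K), ∀ y ∈ C, c * y ∈ interior C :=
    eventually_forall_mul_mem hC isOpen_interior fun y _ ↦ by
      rw [zero_mul]; exact mem_interior_iff_mem_nhds.2 h0C
  have h2 : ∀ᶠ c in 𝓝 (0 : K), m c < 1 :=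
    hmc.continuousAt.eventually_lt continuousAt_const (by rw [(hm0 0).2 rfl]; exact one_pos)
  obtain ⟨c, hc0, hcC, hc1⟩ := exists_ne_zero_of_eventually hd (h1.and h2)
  refine ⟨c, hc0, fun W hW ↦ ?_⟩
  have hmem (n : ℕ) : c ^ n ∈ C := by
    induction n with
    | zero => rw [pow_zero]; exact Set.mem_insert _ _
    | succ n ih => rw [pow_succ']; exact interior_subset (hcC _ ih)
  have hm1 : m 1 = 1 := by
    have h := hmul 1 1
    rw [mul_one] at h
    exact (mul_eq_left₀ (mt (hm0 1).1 one_ne_zero)).1 h.symm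
  have hmp (n : ℕ) : m (c ^ n) = m c ^ n := by
    induction n with
    | zero => rw [pow_zero, pow_zero, hm1]
    | succ n ih => rw [pow_succ, pow_succ, hmul, ih]
  have hCW : IsCompact (C \ interior W) := hC.diff isOpen_interior
  rw [mem_map]
  rcases (C \ interior W).eq_empty_or_nonempty with he | hne
  · filter_upwards with n
    exact interior_subset (s := W) (Set.sdiff_eq_empty.1 he (hmem n))
  · obtain ⟨y, hy, hmin⟩ := hCW.exists_isMinOn hne hmc.continuousOn
    have hy0 : 0 < m y := (hmn y).lt_of_ne' fun h ↦ hy.2 <| by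
      rw [(hm0 y).1 h]; exact mem_interior_iff_mem_nhds.2 hW
    filter_upwards [(tendsto_pow_atTop_nhds_zero_of_lt_one (hmn c) hc1).eventually_lt_const hy0]
      with n hn
    by_contra hnW
    have : m y ≤ m (c ^ n) := hmin ⟨hmem n, fun h ↦ hnW (interior_subset (s := W) h)⟩
    rw [hmp] at this
    exact absurd hn this.not_gt

/-- Outside a compact set, inverses are small. -/
lemma exists_isCompact_forall_inv_mem (hd : ¬ DiscreteTopology K) {N : Set K} (hN : N ∈ 𝓝 0) :
    ∃ D : Set K, IsCompact D ∧ ∀ x ∉ D, x⁻¹ ∈ N := by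
  classical
  obtain ⟨c, hc0, hc⟩ := exists_tendsto_pow_zero hd
  obtain ⟨C, hC, h0C⟩ := exists_compact_mem_nhds (0 : K)
  have hcC : (fun y ↦ c * y) '' C ∈ 𝓝 (0 : K) := by
    simpa using (Homeomorph.mulLeft₀ c hc0).isOpenMap.image_mem_nhds h0C
  let D₀ := C \ interior ((fun y ↦ c * y) '' C)
  have hD₀0 (d) (hd : d ∈ D₀) : d ≠ 0 := by
    rintro rfl
    exact hd.2 (mem_interior_iff_mem_nhds.2 hcC)
  have hD₀ : IsCompact ((fun x ↦ x⁻¹) '' D₀) :=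
    (hC.diff isOpen_interior).image_of_continuousOn
      (continuousOn_inv₀.mono fun d hd ↦ hD₀0 d hd)
  have h1 : ∀ᶠ a in 𝓝 (0 : K), ∀ y ∈ (fun x ↦ x⁻¹) '' D₀, a * y ∈ interior N :=
    eventually_forall_mul_mem hD₀ isOpen_interior fun y _ ↦ by
      rw [zero_mul]; exact mem_interior_iff_mem_nhds.2 hN
  obtain ⟨n₀, hn₀⟩ := eventually_atTop.1 (hc.eventually h1)
  refine ⟨⋃ n ∈ Finset.range (n₀ + 1), (fun y ↦ (c ^ n)⁻¹ * y) '' C,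
    (Finset.range (n₀ + 1)).isCompact_biUnion fun n _ ↦ hC.image (continuous_const_mul _), fun x hx ↦ ?_⟩
  have hx' (n) (hn : n ≤ n₀) : c ^ n * x ∉ C := fun h ↦ hx <| Set.mem_iUnion₂.2
    ⟨n, Finset.mem_range.2 (by lia), c ^ n * x, h, inv_mul_cancel_left₀ (pow_ne_zero n hc0) x⟩
  have hex : ∃ n, c ^ n * x ∈ C := by
    have : Tendsto (fun n : ℕ ↦ c ^ n * x) atTop (𝓝 0) := by simpa using hc.mul_const x
    exact (this.eventually h0C).exists
  have hn := Nat.find_spec hex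
  have hmin (k) (hk : k < Nat.find hex) := Nat.find_min hex hk
  generalize Nat.find hex = n at hn hmin
  have hnn : n₀ < n := not_le.1 fun h ↦ hx' n h hn
  have hx0 : x ≠ 0 := by
    rintro rfl
    exact hx' 0 n₀.zero_le (by simpa using mem_of_mem_nhds h0C)
  have hD : c ^ n * x ∈ D₀ := by
    refine ⟨hn, fun h ↦ ?_⟩
    obtain ⟨y, hy, hyx⟩ := interior_subset h
    obtain ⟨k, rfl⟩ : ∃ k, n = k + 1 := ⟨n - 1, by lia⟩
    rw [pow_succ', mul_assoc] at hyx
    exact hmin k (by lia) (mul_left_cancel₀ hc0 hyx ▸ hy)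
  have h2 : c ^ n * (c ^ n * x)⁻¹ ∈ interior N := hn₀ n hnn.le _ ⟨_, hD, rfl⟩
  rw [mul_inv, mul_inv_cancel_left₀ (pow_ne_zero n hc0)] at h2
  exact interior_subset h2

open Polynomial in
/-- The inverse values of a monic polynomial without roots form a relatively compact set. -/
lemma exists_isCompact_forall_inv_eval_mem (hd : ¬ DiscreteTopology K) {f : K[X]} (hm : f.Monic)
    (hr : ∀ c, f.eval c ≠ 0) : ∃ Q : Set K, IsCompact Q ∧ ∀ x, (f.eval x)⁻¹ ∈ Q := by
  have hopen : IsOpen {z : K | f.reverse.eval z ≠ 0} := isOpen_ne.preimage f.reverse.continuous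
  have h0 : (0 : K) ∈ {z : K | f.reverse.eval z ≠ 0} := by
    simp [← coeff_zero_eq_eval_zero, hm.leadingCoeff]
  obtain ⟨N, hN, hNo, hNc⟩ := local_compact_nhds (hopen.mem_nhds h0)
  obtain ⟨D, hD, hDN⟩ := exists_isCompact_forall_inv_mem hd hN
  refine ⟨(fun x ↦ (f.eval x)⁻¹) '' (insert 0 D) ∪
    (fun z ↦ z ^ f.natDegree * (f.reverse.eval z)⁻¹) '' N, .union ?_ ?_, fun x ↦ ?_⟩
  · exact (hD.insert 0).image (f.continuous.inv₀ hr)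
  · exact hNc.image_of_continuousOn ((continuous_pow _).continuousOn.mul
      (f.reverse.continuous.continuousOn.inv₀ fun z hz ↦ hNo hz))
  · by_cases hx : x ∈ insert 0 D
    · exact .inl ⟨x, hx, rfl⟩
    · rw [Set.mem_insert_iff, not_or] at hx
      refine .inr ⟨x⁻¹, hDN x hx.2, ?_⟩
      let _ := invertibleOfNonzero hx.1
      have h1 := eval₂_reverse_mul_pow (RingHom.id K) x f
      rw [invOf_eq_inv, eval₂_id, eval₂_id] at h1
      simp only [← h1, mul_inv, inv_pow]
      exact mul_comm _ _

end LocallyCompactField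

section ImplicitFunction

open Polynomial

variable {K : Type*} [Field K]

/-- The value of a polynomial in two variables. -/
def evalTwo (f : K[X][X]) (t y : K) : K := eval₂ (evalRingHom t) y f

variable [TopologicalSpace K] [IsTopologicalDivisionRing K]

/-- A polynomial in two variables as a continuous function, with the second variable replaced by a
continuous function. -/
def continuousEval (f : K[X][X]) (Y : C(K × K × K, K)) : C(K × K × K, K) :=
  (f.map (aeval (⟨fun p ↦ p.1, continuous_fst⟩ : C(K × K × K, K)) :
    K[X] →ₐ[K] C(K × K × K, K)).toRingHom).eval Y

lemma continuousEval_apply (f : K[X][X]) (Y : C(K × K × K, K)) (p : K × K × K) :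
    continuousEval f Y p = evalTwo f p.1 (Y p) := by
  let e : C(K × K × K, K) →+* K :=
    { toFun := fun g ↦ g p, map_one' := rfl, map_mul' := fun _ _ ↦ rfl, map_zero' := rfl,
      map_add' := fun _ _ ↦ rfl }
  change e _ = _
  rw [continuousEval, evalTwo, Polynomial.eval_map, Polynomial.hom_eval₂]
  congr 1
  refine Polynomial.ringHom_ext (fun a ↦ ?_) ?_
  · simp [e]
    rfl
  · simp [e]
    rfl

lemma continuous_evalTwo (f : K[X][X]) : Continuous fun p : K × K ↦ evalTwo f p.1 p.2 := by
  have h := (continuousEval f ⟨fun p ↦ p.2.1, continuous_fst.comp continuous_snd⟩).continuous.comp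
    (continuous_fst.prodMk (continuous_snd.prodMk continuous_const) :
      Continuous fun p : K × K ↦ (p.1, p.2, (0 : K)))
  refine h.congr fun p ↦ ?_
  rw [Function.comp_apply, continuousEval_apply]
  rfl

/-- First-order Taylor expansion in the second variable, with continuous remainder. -/
lemma exists_taylor (f : K[X][X]) : ∃ G : K × K × K → K, Continuous G ∧
    (∀ t y, G (t, y, 0) = evalTwo f.derivative t y) ∧
    ∀ t y z, evalTwo f t (y + z) = evalTwo f t y + z * G (t, y, z) := by
  let Y : C(K × K × K, K) := ⟨fun p ↦ p.2.1, continuous_fst.comp continuous_snd⟩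
  let Z : C(K × K × K, K) := ⟨fun p ↦ p.2.2, continuous_snd.comp continuous_snd⟩
  obtain ⟨k, hk⟩ := binomExpansion
    (f.map (aeval (⟨fun p ↦ p.1, continuous_fst⟩ : C(K × K × K, K)) :
      K[X] →ₐ[K] C(K × K × K, K)).toRingHom) Y Z
  rw [derivative_map] at hk
  change continuousEval f (Y + Z) = continuousEval f Y + continuousEval f.derivative Y * Z +
    k * Z ^ 2 at hk
  refine ⟨fun p ↦ (continuousEval f.derivative Y + k * Z) p, ContinuousMap.continuous _,
    fun t y ↦ ?_, fun t y z ↦ ?_⟩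
  · simp [continuousEval_apply, Y, Z]
  · have h := congr($hk (t, y, z))
    simp only [ContinuousMap.add_apply, ContinuousMap.mul_apply, ContinuousMap.pow_apply,
      continuousEval_apply, Y, Z, ContinuousMap.coe_mk] at h ⊢
    rw [h]
    ring

variable [T2Space K] [LocallyCompactSpace K]

/-- Simple roots of polynomials over a locally compact field deform continuously. -/
theorem eventually_exists_root (hd : ¬ DiscreteTopology K) {f : K[X][X]} {a b : K}
    (hf : evalTwo f a b = 0) (hf' : evalTwo f.derivative a b ≠ 0) {W : Set (K × K)}
    (hW : W ∈ 𝓝 (a, b)) : ∀ᶠ t in 𝓝 a, ∃ y, (t, y) ∈ W ∧ evalTwo f t y = 0 := by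
  obtain ⟨m, hmc, hmul, hm0, hmn⟩ := exists_modulus hd
  obtain ⟨G, hGc, hG0, hG⟩ := exists_taylor f
  set v := (evalTwo f.derivative a b)⁻¹
  have hv : v ≠ 0 := inv_ne_zero hf'
  have hE := continuous_evalTwo f
  let Good : Set (K × K × K) := {p | m (1 - v * G p) < 1 ∧ G p ≠ 0}
  have hGood : IsOpen Good :=
    (isOpen_lt (hmc.comp (continuous_const.sub (continuous_const.mul hGc))) continuous_const).inter
      (isOpen_ne.preimage hGc)
  have habG : (a, b, (0 : K)) ∈ Good := by
    constructor
    · rw [hG0, inv_mul_cancel₀ hf', sub_self, (hm0 0).2 rfl]; exact one_pos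
    · rw [hG0]; exact hf'
  obtain ⟨T₁, hT₁, S, hS, hTS⟩ := mem_nhds_prod_iff.1 (hGood.mem_nhds habG)
  obtain ⟨B₁, hB₁, Z, hZ, hBZ⟩ := mem_nhds_prod_iff.1 hS
  obtain ⟨T₂, hT₂, B₂, hB₂, hTB⟩ := mem_nhds_prod_iff.1 hW
  have hshift : (fun y ↦ y - b) ⁻¹' Z ∈ 𝓝 b :=
    (continuous_id.sub continuous_const).continuousAt (by simpa using hZ)
  obtain ⟨T, hT, hTT, hTc⟩ := local_compact_nhds (inter_mem hT₁ hT₂)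
  obtain ⟨B, hB, hBB, hBc⟩ := local_compact_nhds (inter_mem (inter_mem hB₁ hB₂) hshift)
  have hbB₁ : b ∈ B₁ := mem_of_mem_nhds hB₁
  let N (p : K × K) : K := -(v * evalTwo f p.1 p.2)
  have hN : Continuous N := (continuous_const.mul hE).neg
  let Bad : Set (K × K) := (T ×ˢ B) ∩ ({p | m (evalTwo f p.1 p.2) ≤ m (evalTwo f p.1 b)} ∩
    {p | p.2 + N p ∈ interior B ∧ N p ∈ interior Z}ᶜ)
  have hBadc : IsCompact Bad := (hTc.prod hBc).inter_right <| by
    refine (isClosed_le (hmc.comp hE) (hmc.comp (hE.comp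
      (continuous_fst.prodMk continuous_const)))).inter (isClosed_compl_iff.2 ?_)
    exact (isOpen_interior.preimage (continuous_snd.add hN)).inter (isOpen_interior.preimage hN)
  have haBad : a ∉ Prod.fst '' Bad := by
    rintro ⟨⟨t, y⟩, ⟨⟨-, hyB⟩, hle, hbad⟩, rfl⟩
    have hy0 : evalTwo f t y = 0 := by
      have h : m (evalTwo f t y) ≤ m (evalTwo f t b) := hle
      rw [hf, (hm0 0).2 rfl] at h
      exact (hm0 _).1 (le_antisymm h (hmn _))
    have h1 := hG t b (y - b)
    rw [add_sub_cancel, hy0, hf, zero_add] at h1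
    have h2 : G (t, b, y - b) ≠ 0 :=
      (hTS (Set.mk_mem_prod (mem_of_mem_nhds hT₁)
        (hBZ (Set.mk_mem_prod hbB₁ (show y - b ∈ Z from (hBB hyB).2))))).2
    have h3 : y = b := sub_eq_zero.1 ((mul_eq_zero.1 h1.symm).resolve_right h2)
    have h4 : N (t, y) = 0 := by simp [N, hy0]
    refine hbad ⟨?_, ?_⟩
    · change y + N (t, y) ∈ interior B
      rw [h4, add_zero, h3]
      exact mem_interior_iff_mem_nhds.2 hB
    · rw [h4]
      exact mem_interior_iff_mem_nhds.2 hZ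
  filter_upwards [hT, (hBadc.image continuous_fst).isClosed.isOpen_compl.mem_nhds haBad]
    with t ht htBad
  obtain ⟨y, hy, hmin⟩ := hBc.exists_isMinOn ⟨b, mem_of_mem_nhds hB⟩
    (hmc.comp (hE.comp (continuous_const.prodMk continuous_id : Continuous fun y ↦ (t, y)))).continuousOn
  refine ⟨y, hTB ⟨(hTT ht).2, (hBB hy).1.2⟩, ?_⟩
  by_contra hne
  have hgood : y + N (t, y) ∈ interior B ∧ N (t, y) ∈ interior Z := by
    by_contra hcon
    exact htBad ⟨(t, y), ⟨⟨ht, hy⟩, hmin (mem_of_mem_nhds hB), hcon⟩, rfl⟩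
  have h1 := hG t y (N (t, y))
  have h2 : evalTwo f t (y + N (t, y)) = evalTwo f t y * (1 - v * G (t, y, N (t, y))) := by
    rw [h1]; simp only [N]; ring
  have h3 : m (1 - v * G (t, y, N (t, y))) < 1 :=
    (hTS ⟨(hTT ht).1, hBZ ⟨(hBB hy).1.1, interior_subset hgood.2⟩⟩).1
  have h4 : m (evalTwo f t y) ≤ m (evalTwo f t (y + N (t, y))) :=
    hmin (interior_subset hgood.1)
  rw [h2, hmul] at h4
  have h5 : 0 < m (evalTwo f t y) := (hmn _).lt_of_ne' (mt (hm0 _).1 hne)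
  nlinarith

end ImplicitFunction

section Comparison

open Polynomial

variable {K : Type u} [Field K] [TopologicalSpace K] [IsTopologicalDivisionRing K] [T2Space K]
  [LocallyCompactSpace K]

/-- Over a locally compact field, étale images in the line are open for the field topology. -/
lemma IsAlgEtaleImage.isOpen_preimage_lineEquiv (hd : ¬ DiscreteTopology K)
    {S : Set (K[X] →ₐ[K] K)} (hS : IsAlgEtaleImage S) : IsOpen (lineEquiv K ⁻¹' S) := by
  obtain ⟨B, _, _, φ, hφ, rfl⟩ := hS
  rw [isOpen_iff_mem_nhds]
  rintro a ⟨y, hy⟩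
  algebraize [φ.toRingHom]
  have htow : IsScalarTower K K[X] B := .of_algebraMap_eq' φ.comp_algebraMap.symm
  have hprime : (RingHom.ker y).IsPrime := RingHom.ker_isPrime _
  have : Algebra.IsEtaleAt K[X] (RingHom.ker y) :=
    Algebra.FormallyEtale.comp K[X] B (Localization.AtPrime (RingHom.ker y))
  obtain ⟨g, hg, hst⟩ := Algebra.IsEtaleAt.exists_isStandardEtale (R := K[X]) (RingHom.ker y)
  obtain ⟨P⟩ := hst.nonempty_standardEtalePresentation
  obtain ⟨z, rfl⟩ := (range_pullPt_localizationAway g).ge (show y g ≠ 0 from hg)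
  have hz : z.toRingHom.comp (algebraMap K[X] (Localization.Away g)) = evalRingHom a := by
    refine RingHom.ext fun p ↦ ?_
    have h1 := congr($hy p)
    change z (algebraMap K[X] (Localization.Away g) p) = p.eval a
    rw [IsScalarTower.algebraMap_apply K[X] B (Localization.Away g)]
    exact h1.trans (by simp [lineEquiv, Polynomial.coe_aeval_eq_eval])
  let b := z P.x
  have hev (p : K[X][X]) : evalTwo p a b = z (aeval P.x p) := by
    rw [evalTwo, ← hz, Polynomial.aeval_def]
    exact (Polynomial.hom_eval₂ p _ z.toRingHom P.x).symm
  have h0 : evalTwo P.P.f a b = 0 := by rw [hev, P.hasMap.1, map_zero]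
  have h1 : evalTwo P.P.f.derivative a b ≠ 0 := by
    rw [hev]; exact (P.hasMap.isUnit_derivative_f.map z).ne_zero
  have h2 : evalTwo P.P.g a b ≠ 0 := by
    rw [hev]; exact (P.hasMap.2.map z).ne_zero
  have hW : {p : K × K | evalTwo P.P.g p.1 p.2 ≠ 0} ∈ 𝓝 (a, b) :=
    (isOpen_ne.preimage (continuous_evalTwo P.P.g)).mem_nhds h2
  filter_upwards [eventually_exists_root hd h0 h1 hW] with t ⟨s, hsg, hsf⟩
  let _ : Algebra K[X] K := (evalRingHom t).toAlgebra
  have hmap : P.P.HasMap s := ⟨hsf, IsUnit.mk0 _ hsg⟩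
  let ψ : B →ₐ[K[X]] K := ((P.P.lift s hmap).comp P.equivRing.toAlgHom).comp
    (IsScalarTower.toAlgHom K[X] B (Localization.Away g))
  have hψ (p : K[X]) : ψ (algebraMap K[X] B p) = p.eval t := ψ.commutes p
  refine ⟨⟨ψ.toRingHom, fun k ↦ ?_⟩, ?_⟩
  · change ψ (algebraMap K B k) = k
    rw [IsScalarTower.algebraMap_apply K K[X] B, hψ, Polynomial.algebraMap_eq, eval_C]
  · refine Polynomial.algHom_ext ?_
    have := hψ X
    rw [eval_X] at this
    exact this.trans (by simp [lineEquiv])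

/-- Over a locally compact field which is not separably closed, sets which are open for the field
topology are étale-open. -/
lemma isOpen_image_lineEquiv (hK : ¬ IsSepClosed K) (hd : ¬ DiscreteTopology K) {W : Set K}
    (hW : IsOpen W) : IsOpen {x : K[X] →ₐ[K] K | x X ∈ W} := by
  have : Infinite K := by
    have := neBot_punctured_nhds_zero hd
    by_contra h
    rw [not_infinite_iff_finite] at h
    exact hd inferInstance
  obtain ⟨f, hm, hi, hs, hr⟩ := exists_irreducible_of_not_isSepClosed hK
  obtain ⟨c, hc⟩ := exists_derivative_eval_ne_zero hi hs
  obtain ⟨Q, hQ, hfQ⟩ := exists_isCompact_forall_inv_eval_mem hd hm hr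
  have hSo := isOpen_inv_mem (isOpen_exists_eval_eq f)
  set S := {x : K[X] →ₐ[K] K | x X ≠ 0 ∧ lineEquiv K (x X)⁻¹ ∈
    {x : K[X] →ₐ[K] K | ∃ a : K, x X = f.eval a ∧ f.derivative.eval a ≠ 0}}
  have hX (s : K) : lineEquiv K s X = s := (lineEquiv K).symm_apply_apply s
  have hSQ (x) (hx : x ∈ S) : x X ∈ Q := by
    obtain ⟨-, a, ha, -⟩ := hx
    rw [hX] at ha
    rw [← inv_inv (x X), ha]
    exact hfQ a
  let s₀ : K := (f.eval c)⁻¹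
  have hs₀ : lineEquiv K s₀ ∈ S := by
    refine ⟨?_, c, ?_, hc⟩
    · rw [hX]; exact inv_ne_zero (hr c)
    · rw [hX, hX, inv_inv]
  rw [isOpen_iff_forall_mem_open]
  intro x hx
  obtain ⟨α, hα0, hα⟩ := exists_ne_zero_of_eventually hd
    (eventually_forall_mul_mem (x := (0 : K)) (U := (fun z ↦ x X + z) ⁻¹' W)
      (hQ.image (continuous_id.sub continuous_const : Continuous fun q ↦ q - s₀))
      (hW.preimage (continuous_const_add _)) fun y _ ↦ by simpa using hx)
  let φ : K[X] →ₐ[K] K[X] := aeval (C α⁻¹ * X + C (s₀ - α⁻¹ * x X))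
  refine ⟨pullPt φ ⁻¹' S, fun y hy ↦ ?_, hSo.preimage (continuous_pullPt φ), ?_⟩
  · have h1 := hα _ ⟨_, hSQ _ hy, rfl⟩
    rw [pullPt_affine] at h1
    have h2 : x X + α * (α⁻¹ * y X + (s₀ - α⁻¹ * x X) - s₀) = y X := by field_simp; ring
    change x X + α * (α⁻¹ * y X + (s₀ - α⁻¹ * x X) - s₀) ∈ W at h1
    rw [h2] at h1
    exact h1
  · have : pullPt φ x = lineEquiv K s₀ := by
      refine Polynomial.algHom_ext ?_
      rw [pullPt_affine, hX]
      ring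
    rw [Set.mem_preimage, this]
    exact hs₀

/-- Over a locally compact field which is not separably closed, the étale-open topology on the line
is the field topology. -/
def lineHomeomorphOfLocallyCompact (hK : ¬ IsSepClosed K) (hd : ¬ DiscreteTopology K) :
    K ≃ₜ (K[X] →ₐ[K] K) where
  toEquiv := lineEquiv K
  continuous_toFun := continuous_generateFrom_iff.2 fun _ hS ↦
    IsAlgEtaleImage.isOpen_preimage_lineEquiv hd hS
  continuous_invFun := ⟨fun _ hW ↦ isOpen_image_lineEquiv hK hd hW⟩

end Comparison

end EtaleOpen

end

theorem mainTheorem8 (K : Type u) [Field K] [Infinite K] (hK : ¬ IsSepClosed K) :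
    ((∃ V : Over (Spec (CommRingCat.of K)), EtaleOpen.IsVariety V ∧
        ∃ U : Set (EtaleOpen.Points V), IsOpen U ∧ U.Infinite ∧ LocallyCompactSpace U) ↔
      LocallyCompactSpace (EtaleOpen.Points (EtaleOpen.affineLine K))) ∧
    List.TFAE [
      ∃ V : Over (Spec (CommRingCat.of K)), EtaleOpen.IsVariety V ∧
        ∃ U : Set (EtaleOpen.Points V), IsOpen U ∧ U.Infinite ∧ LocallyCompactSpace U ∧
          ¬ DiscreteTopology U,
      LocallyCompactSpace (EtaleOpen.Points (EtaleOpen.affineLine K)) ∧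
        ¬ DiscreteTopology (EtaleOpen.Points (EtaleOpen.affineLine K)),
      EtaleOpen.IsLocalField K] := by
  have hinf : (Set.univ : Set (EtaleOpen.Points (EtaleOpen.affineLine K))).Infinite :=
    Set.infinite_univ_iff.2 EtaleOpen.infinite_affineLine
  let e := Homeomorph.Set.univ (EtaleOpen.Points (EtaleOpen.affineLine K))
  refine ⟨⟨?_, fun h ↦ ?_⟩, ?_⟩
  · rintro ⟨V, hV, U, hU, hUi, hUc⟩
    exact EtaleOpen.locallyCompactSpace_affineLine_of_variety hV hU hUi hUc
  · exact ⟨_, EtaleOpen.isVariety_affineLine, Set.univ, isOpen_univ, hinf,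
      e.isOpenEmbedding.locallyCompactSpace⟩
  tfae_have 1 → 2 := by
    rintro ⟨V, hV, U, hU, hUi, hUc, hUd⟩
    refine ⟨EtaleOpen.locallyCompactSpace_affineLine_of_variety hV hU hUi hUc, fun h ↦ hUd ?_⟩
    have := EtaleOpen.discreteTopology_points_of_affineLine hV h
    infer_instance
  tfae_have 2 → 1 := by
    rintro ⟨h, hd⟩
    exact ⟨_, EtaleOpen.isVariety_affineLine, Set.univ, isOpen_univ, hinf,
      e.isOpenEmbedding.locallyCompactSpace, fun _ ↦ hd e.symm.isEmbedding.discreteTopology⟩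
  tfae_have 2 → 3 := by
    rintro ⟨h, hd⟩
    rw [EtaleOpen.locallyCompactSpace_affineLine_iff] at h
    rw [EtaleOpen.discreteTopology_affineLine_iff] at hd
    exact EtaleOpen.isLocalField_of_line hK hd
  tfae_have 3 → 2 := by
    rintro ⟨_, _, _, _, hd⟩
    rw [EtaleOpen.locallyCompactSpace_affineLine_iff, EtaleOpen.discreteTopology_affineLine_iff]
    let e' := EtaleOpen.lineHomeomorphOfLocallyCompact hK hd
    exact ⟨e'.symm.isOpenEmbedding.locallyCompactSpace,
      fun _ ↦ hd e'.isEmbedding.discreteTopology⟩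
  tfae_finish
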